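/- For every integer $n\ge 1$ let $P_n^{(1)}(x)=\sum_{k=0}^n a^{(1)}_{k:n}x^k$ and $P_n^{(2)}(x)=\sum_{k=0}^n a^{(2)}_{k:n}x^k$ be real polynomials, not identically zero, of degree at most $n$, all of whose complex roots are real and nonpositive. For a nonzero polynomial $P$ of degree at most $n$ with only nonpositive roots let $$[\![P]\!]_n=\frac1n\sum_{z:\,P(z)=0}\delta_z+\frac{n-\deg P}{n}\,\delta_{-\infty}$$ (zeros counted with multiplicity) be its empirical distribution of zeros, a probability measure on $[-\infty,0]$. For a probability measure $\mu$ on $[-\infty,0]$ let $G_\mu(t)=\int_{(-\infty,0]}\frac{\mu(\mathrm dz)}{t-z}$ be its Cauchy transform, and put $I_\mu=(\mu(\{0\}),\,1-\mu(\{-\infty\}))$. Suppose that $[\![P_n^{(1)}]\!]_n\to\mu_1$ and $[\![P_n^{(2)}]\!]_n\to\mu_2$ weakly as $n\to\infty$, for some probability measures $\mu_1,\mu_2$ on $[-\infty,0]$, and that $I_{\mu_1}\cap I_{\mu_2}\neq\varnothing$. Then, for all sufficiently large $n$, the Hadamard product $$\big[P_n^{(1)}\odot_n P_n^{(2)}\big](x)=\sum_{k=0}^n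 a^{(1)}_{k:n}a^{(2)}_{k:n}x^k$$ is not identically zero and has only real nonpositive roots, and there is a probability measure $\mu$ on $[-\infty,0]$ such that $[\![P_n^{(1)}\odot_n P_n^{(2)}]\!]_n\to\mu$ weakly. For $i=1,2$ the function $t\mapsto tG_{\mu_i}(t)$ is a continuous strictly increasing bijection of $(0,\infty)$ onto $I_{\mu_i}$. The measure $\mu$ is the unique probability measure on $[-\infty,0]$ with the following property: $t\mapsto tG_\mu(t)$ is a continuous strictly increasing bijection of $(0,\infty)$ onto $I_{\mu_1}\cap I_{\mu_2}$, and its inverse is the product, on $I_{\mu_1}\cap I_{\mu_2}$, of the inverse of $t\mapsto tG_{\mu_1}(t)$ and the inverse of $t\mapsto tG_{\mu_2}(t)$. -/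

import Mathlib

open Filter Topology MeasureTheory Polynomial
open scoped NNReal

/-- `P` is not the zero polynomial and all its complex roots are real and nonpositive. -/
def HasNonposRoots (P : ℝ[X]) : Prop :=
  P ≠ 0 ∧ ∀ z : ℂ, aeval z P = 0 → z.im = 0 ∧ z.re ≤ 0

/-- The Hadamard product `∑_{k=0}^n a_k b_k x^k` of `P = ∑ a_k x^k` and `Q = ∑ b_k x^k`. -/
noncomputable def hadamardProduct (n : ℕ) (P Q : ℝ[X]) : ℝ[X] :=
  ∑ k ∈ Finset.range (n + 1), monomial k (P.coeff k * Q.coeff k)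

/-- The empirical distribution of zeros of a polynomial `P` of degree at most `n` having only
real nonpositive roots: weight `1/n` at each root, counted with multiplicity, and the remaining
mass `(n - deg P)/n` at `-∞`. The multiset `P.roots` of real roots contains all the complex roots
when `HasNonposRoots P` holds. -/
noncomputable def empiricalZeros (n : ℕ) (P : ℝ[X]) : FiniteMeasure EReal :=
  (n : ℝ≥0)⁻¹ •
    ((P.roots.map fun z : ℝ => (diracProba (z : EReal)).toFiniteMeasure).sum +
      (n - P.natDegree) • (diracProba (⊥ : EReal)).toFiniteMeasure)

/-- The Cauchy transform `G_μ(t) = ∫_ℝ μ(dz) / (t - z)` of a measure on `[-∞, ∞]`; the atoms at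
`±∞` do not contribute. -/
noncomputable def cauchyTransform (μ : Measure EReal) (t : ℂ) : ℂ :=
  ∫ z in Set.range ((↑) : ℝ → EReal), (t - (z.toReal : ℂ))⁻¹ ∂μ

/-- The function `t ↦ t G_μ(t)` on the real line. For `μ` carried by `[-∞, 0]` and `t > 0`, the
number `t G_μ(t)` is real, so that taking the real part only changes its type. -/
noncomputable def tCauchy (μ : Measure EReal) (t : ℝ) : ℝ :=
  ((t : ℂ) * cauchyTransform μ t).re

/-- The inverse `α ↦ t`, `t > 0`, of the restriction of `t ↦ t G_μ(t)` to `(0, ∞)`. It is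
meaningful on the image of `(0, ∞)`, if the restriction is injective. -/
noncomputable def tCauchyInv (μ : Measure EReal) : ℝ → ℝ :=
  Function.invFunOn (tCauchy μ) (Set.Ioi 0)

/-- The open interval `(μ({0}), 1 - μ({-∞}))`. -/
def massInterval (μ : Measure EReal) : Set ℝ :=
  Set.Ioo (μ.real {0}) (1 - μ.real {⊥})

/-- `t ↦ t G_μ(t)` is a continuous strictly increasing bijection of `(0, ∞)` onto `I`. -/
def IsTCauchyBij (μ : Measure EReal) (I : Set ℝ) : Prop :=
  ContinuousOn (tCauchy μ) (Set.Ioi 0) ∧ StrictMonoOn (tCauchy μ) (Set.Ioi 0) ∧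
    Set.BijOn (tCauchy μ) (Set.Ioi 0) I

/-- The inverse of `t ↦ t G_μ(t)` is the product of the inverses of `t ↦ t G_{μ₁}(t)` and
`t ↦ t G_{μ₂}(t)`: its domain is the intersection of their domains, and there it equals their
product. -/
def HasProductInverse (μ₁ μ₂ μ : Measure EReal) : Prop :=
  IsTCauchyBij μ (massInterval μ₁ ∩ massInterval μ₂) ∧
    ∀ α ∈ massInterval μ₁ ∩ massInterval μ₂,
      tCauchyInv μ α = tCauchyInv μ₁ α * tCauchyInv μ₂ α

open scoped ComplexConjugate

/-! ### Log-concave coefficient sequences -/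

/-- A nonnegative sequence that is log-concave and has no internal zeros. -/
structure IsLogConcave (a : ℕ → ℝ) : Prop where
  nonneg : ∀ k, 0 ≤ a k
  mul_le : ∀ i j, i ≤ j → a i * a (j + 1) ≤ a (i + 1) * a j

theorem IsLogConcave.mul_X_add_C {p : ℝ[X]} (h : IsLogConcave p.coeff) {c : ℝ} (hc : 0 ≤ c) :
    IsLogConcave (p * (X + C c)).coeff := by
  have h0 : (p * (X + C c)).coeff 0 = c * p.coeff 0 := by simp [mul_add, mul_comm]
  have hs : ∀ k, (p * (X + C c)).coeff (k + 1) = p.coeff k + c * p.coeff (k + 1) := by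
    intro k; simp [mul_add, mul_comm c]
  have hn := h.nonneg
  refine ⟨fun k => ?_, fun i j hij => ?_⟩
  · cases k with
    | zero => rw [h0]; exact mul_nonneg hc (hn 0)
    | succ k => rw [hs]; exact add_nonneg (hn k) (mul_nonneg hc (hn _))
  · rcases hij.eq_or_lt with rfl | hij
    · exact (mul_comm _ _).le
    obtain ⟨j, rfl⟩ : ∃ l, j = l + 1 := ⟨j - 1, by omega⟩
    rw [hs, hs]
    cases i with
    | zero =>
      rw [h0, hs]
      have h1 := mul_le_mul_of_nonneg_left (h.mul_le 0 (j + 1) (by omega)) (mul_nonneg hc hc)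
      nlinarith [mul_nonneg (hn 0) (hn j), mul_nonneg hc (mul_nonneg (hn 1) (hn j))]
    | succ i =>
      rw [hs, hs]
      have hij' : i ≤ j := by omega
      have h1 := h.mul_le i j hij'
      have h2 := mul_le_mul_of_nonneg_left (h.mul_le (i + 1) (j + 1) (by omega))
        (mul_nonneg hc hc)
      have h3 : p.coeff i * p.coeff (j + 1 + 1) ≤ p.coeff (i + 1 + 1) * p.coeff j := by
        rcases hij'.eq_or_lt with rfl | hlt
        · exact (mul_comm _ _).le
        · exact (h.mul_le i (j + 1) (by omega)).trans (h.mul_le (i + 1) j (by omega))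
      nlinarith [mul_le_mul_of_nonneg_left h3 hc]

theorem IsLogConcave.coeff_prod_X_sub_C (s : Multiset ℝ) (hs : ∀ r ∈ s, r ≤ 0) :
    IsLogConcave (s.map fun r => X - C r).prod.coeff := by
  induction s using Multiset.induction_on with
  | empty =>
    refine ⟨fun k => ?_, fun i j hij => ?_⟩
    · simp only [Multiset.map_zero, Multiset.prod_zero, coeff_one]; split_ifs <;> norm_num
    · simp [coeff_one]
  | cons r s ih =>
    have := (ih fun x hx => hs x (Multiset.mem_cons_of_mem hx)).mul_X_add_C (c := -r)
      (by have := hs r (Multiset.mem_cons_self r s); linarith)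
    rw [Multiset.map_cons, Multiset.prod_cons, mul_comm, sub_eq_add_neg, ← C_neg]
    exact this

theorem IsLogConcave.mul {a b : ℕ → ℝ} (ha : IsLogConcave a) (hb : IsLogConcave b) :
    IsLogConcave fun k => a k * b k := by
  refine ⟨fun k => mul_nonneg (ha.nonneg k) (hb.nonneg k), fun i j hij => ?_⟩
  have := mul_le_mul (ha.mul_le i j hij) (hb.mul_le i j hij)
    (mul_nonneg (hb.nonneg _) (hb.nonneg _)) (mul_nonneg (ha.nonneg _) (ha.nonneg _))
  nlinarith

theorem IsLogConcave.mul_pow {a : ℕ → ℝ} (ha : IsLogConcave a) {t : ℝ} (ht : 0 ≤ t) :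
    IsLogConcave fun k => a k * t ^ k :=
  ha.mul ⟨fun k => pow_nonneg ht k, fun i j _ => by
    rw [← pow_add, ← pow_add]; exact (congrArg (t ^ ·) (by ring)).le⟩

theorem IsLogConcave.ne_zero_of_le_of_le {a : ℕ → ℝ} (ha : IsLogConcave a) {i j k : ℕ}
    (hi : a i ≠ 0) (hj : a j ≠ 0) (hik : i ≤ k) (hkj : k ≤ j) : a k ≠ 0 := by
  induction k, hik using Nat.le_induction with
  | base => exact hi
  | succ k hk ih =>
    intro h0
    obtain ⟨l, rfl⟩ : ∃ l, j = l + 1 := ⟨j - 1, by omega⟩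
    have h1 := ha.mul_le k l (by omega)
    rw [h0, zero_mul] at h1
    have h2 := (ha.nonneg k).lt_of_ne' (ih (by omega))
    have h3 := (ha.nonneg (l + 1)).lt_of_ne' hj
    exact absurd h1 (not_le.2 (mul_pos h2 h3))

/-! ### Polynomials with nonpositive roots -/

theorem hasNonposRoots_iff {P : ℝ[X]} :
    HasNonposRoots P ↔ P ≠ 0 ∧ ∀ z ∈ Complex.slitPlane, aeval z P ≠ 0 := by
  refine and_congr_right fun _ => forall_congr' fun z => ?_
  rw [Complex.mem_slitPlane_iff]
  constructor
  · intro h hz h0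
    obtain ⟨h1, h2⟩ := h h0
    rcases hz with hz | hz
    · linarith
    · exact hz h1
  · intro h h0
    by_contra hc
    refine h ?_ h0
    by_contra hc'
    push Not at hc'
    exact hc ⟨hc'.2, hc'.1⟩

theorem HasNonposRoots.splits {P : ℝ[X]} (h : HasNonposRoots P) : P.Splits := by
  refine Splits.of_splits_map (algebraMap ℝ ℂ) (IsAlgClosed.splits _) fun z hz => ?_
  have h0 : aeval z P = 0 := by
    rw [aeval_def, ← eval_map]; exact (mem_roots'.1 hz).2
  exact ⟨z.re, Complex.ext (by simp) (by simp [(h.2 z h0).1])⟩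

theorem HasNonposRoots.nonpos_of_mem_roots {P : ℝ[X]} (h : HasNonposRoots P) {r : ℝ}
    (hr : r ∈ P.roots) : r ≤ 0 := by
  have h0 : aeval (r : ℂ) P = 0 := by
    have : aeval (algebraMap ℝ ℂ r) P = algebraMap ℝ ℂ (aeval r P) :=
      aeval_algebraMap_apply _ _ _
    rw [coe_aeval_eq_eval, (mem_roots'.1 hr).2, map_zero] at this
    exact this
  simpa using (h.2 _ h0).2

theorem HasNonposRoots.isLogConcave {P : ℝ[X]} (h : HasNonposRoots P) :
    IsLogConcave fun k => P.leadingCoeff⁻¹ * P.coeff k := by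
  have h1 := IsLogConcave.coeff_prod_X_sub_C P.roots fun r hr => h.nonpos_of_mem_roots hr
  convert h1 using 2 with k
  have hl : P.leadingCoeff ≠ 0 := leadingCoeff_ne_zero.2 h.1
  have hk := congrArg (fun p => coeff p k) h.splits.eq_prod_roots
  simp only [coeff_C_mul] at hk
  rw [hk, inv_mul_cancel_left₀ hl]

theorem HasNonposRoots.coeff_ne_zero {P : ℝ[X]} (h : HasNonposRoots P) {i j k : ℕ}
    (hi : P.coeff i ≠ 0) (hj : P.coeff j ≠ 0) (hik : i ≤ k) (hkj : k ≤ j) : P.coeff k ≠ 0 := by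
  have hl : P.leadingCoeff⁻¹ ≠ 0 := inv_ne_zero (leadingCoeff_ne_zero.2 h.1)
  exact right_ne_zero_of_mul (h.isLogConcave.ne_zero_of_le_of_le (mul_ne_zero hl hi)
    (mul_ne_zero hl hj) hik hkj)

/-! ### Hadamard products of polynomials with nonpositive roots -/

/-- If `f` has no root in the closed half-plane `a ≤ Re (y ū)`, then neither does
`s f' + c f` when `Re (s ū) > 0` and `c > 0`. -/
theorem eval_smul_derivative_add_ne_zero {u s c : ℂ} {a : ℝ} (hs : 0 < (s * conj u).re)
    (hc : 0 < c.re) (hc' : c.im = 0) {f : ℂ[X]}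
    (hf : ∀ y : ℂ, a ≤ (y * conj u).re → f.eval y ≠ 0) (y : ℂ) (hy : a ≤ (y * conj u).re) :
    (s • derivative f + c • f).eval y ≠ 0 := by
  intro h0
  have hfy := hf y hy
  have hsum := (IsAlgClosed.splits f).eval_derivative_div_eval_of_ne_zero hfy
  rw [eval_add, eval_smul, eval_smul, smul_eq_mul, smul_eq_mul] at h0
  set w : ℂ := s * conj u with hw
  have hu0 : conj u ≠ 0 := by rintro h; simp [hw, h] at hs
  have hs0 : s ≠ 0 := by rintro rfl; simp [hw] at hs
  have hre : ∀ m : Multiset ℂ, (∀ z ∈ m, (z * conj u).re < a) →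
      0 ≤ ((m.map fun z => 1 / (y - z)).sum * (conj u)⁻¹).re := by
    intro m
    induction m using Multiset.induction_on with
    | empty => simp
    | cons z m ih =>
      intro hm
      rw [Multiset.map_cons, Multiset.sum_cons, add_mul, Complex.add_re]
      refine add_nonneg ?_ (ih fun x hx => hm x (Multiset.mem_cons_of_mem hx))
      have hz := hm z (Multiset.mem_cons_self z m)
      rw [one_div, ← mul_inv, Complex.inv_re, sub_mul, Complex.sub_re]
      exact div_nonneg (by linarith) (Complex.normSq_nonneg _)
  have h1 := hre f.roots fun z hz => by
    by_contra hcon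
    exact hf z (not_lt.1 hcon) (mem_roots'.1 hz).2
  rw [← hsum] at h1
  have h2 : f.derivative.eval y / f.eval y * (conj u)⁻¹ = -(c * w⁻¹) := by
    rw [hw, mul_inv]; field_simp; linear_combination h0
  have h3 : (c * w⁻¹).re = c.re * (w.re / Complex.normSq w) := by
    rw [Complex.mul_re, hc', Complex.inv_re]; ring
  have hw0 : w ≠ 0 := mul_ne_zero hs0 hu0
  rw [h2, Complex.neg_re, h3] at h1
  have := mul_pos hc (div_pos hs (Complex.normSq_pos.2 hw0))
  linarith

theorem eval_aeval_derivative_ne_zero {u s : ℂ} {a : ℝ} (hs : 0 < (s * conj u).re) {Q : ℂ[X]}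
    (hQ0 : Q ≠ 0) (hQ : ∀ z, Q.eval z = 0 → z.im = 0 ∧ z.re < 0) {f : ℂ[X]}
    (hf : ∀ y : ℂ, a ≤ (y * conj u).re → f.eval y ≠ 0) (y : ℂ) (hy : a ≤ (y * conj u).re) :
    (aeval (s • derivative : Module.End ℂ ℂ[X]) Q f).eval y ≠ 0 := by
  have key : ∀ m : Multiset ℂ, (∀ z ∈ m, z.im = 0 ∧ z.re < 0) →
      ∀ y : ℂ, a ≤ (y * conj u).re → (aeval (s • derivative : Module.End ℂ ℂ[X])
        (m.map fun z => X - C z).prod f).eval y ≠ 0 := by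
    intro m
    induction m using Multiset.induction_on with
    | empty => simpa using hf
    | cons z m ih =>
      intro hm y hy
      have hz := hm z (Multiset.mem_cons_self z m)
      have := eval_smul_derivative_add_ne_zero (c := -z) hs (by simpa using hz.2)
        (by simpa using hz.1) (ih fun x hx => hm x (Multiset.mem_cons_of_mem hx)) y hy
      rw [Multiset.map_cons, Multiset.prod_cons, map_mul, Module.End.mul_apply, map_sub, aeval_X,
        aeval_C, LinearMap.sub_apply, LinearMap.smul_apply, Module.algebraMap_end_apply,
        sub_eq_add_neg, ← neg_smul]
      exact this
  rw [(IsAlgClosed.splits Q).eq_prod_roots, map_mul, Module.End.mul_apply, aeval_C,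
    Module.algebraMap_end_apply, eval_smul, smul_eq_mul]
  exact mul_ne_zero (leadingCoeff_ne_zero.2 hQ0)
    (key Q.roots (fun z hz => hQ z (mem_roots'.1 hz).2) y hy)

theorem aeval_smul_derivative_apply (s : ℂ) (Q f : ℂ[X]) {N : ℕ} (hN : Q.natDegree < N) :
    aeval (s • derivative : Module.End ℂ ℂ[X]) Q f =
      ∑ k ∈ Finset.range N, (Q.coeff k * s ^ k) • derivative^[k] f := by
  rw [aeval_eq_sum_range' hN, LinearMap.sum_apply]
  refine Finset.sum_congr rfl fun k _ => ?_
  rw [_root_.smul_pow, LinearMap.smul_apply, LinearMap.smul_apply, smul_smul,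
    Module.End.pow_apply]

theorem Complex.exists_half_plane {x : ℂ} (hx : x ∈ Complex.slitPlane) :
    ∃ u : ℂ, 0 < u.re ∧ 0 < (x * conj u).re := by
  have hx0 := norm_pos_iff.2 (Complex.slitPlane_ne_zero hx)
  have hre : 0 < ‖x‖ + x.re := by
    rcases Complex.mem_slitPlane_iff.1 hx with h | h
    · linarith
    · linarith [(abs_lt.1 (Complex.abs_re_lt_norm.2 h)).1]
  refine ⟨(‖x‖ : ℂ) + x, by simpa using hre, ?_⟩
  have : (x * conj ((‖x‖ : ℂ) + x)).re = ‖x‖ * (‖x‖ + x.re) := by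
    rw [map_add, mul_add, Complex.mul_conj, Complex.conj_ofReal, Complex.add_re,
      Complex.re_mul_ofReal, Complex.ofReal_re, Complex.normSq_eq_norm_sq]
    ring
  rw [this]
  exact mul_pos hx0 hre

/-- A composition theorem of Schur. -/
theorem sum_factorial_mul_coeff_ne_zero {P Q : ℂ[X]} (hP : ∀ z, P.eval z = 0 → z.im = 0 ∧ z.re < 0)
    (hQ0 : Q ≠ 0) (hQ : ∀ z, Q.eval z = 0 → z.im = 0 ∧ z.re < 0) {x : ℂ}
    (hx : x ∈ Complex.slitPlane) :
    ∑ k ∈ Finset.range (Q.natDegree + 1), (k.factorial : ℂ) * (P.coeff k * Q.coeff k) * x ^ k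
      ≠ 0 := by
  obtain ⟨u, hu, hxu⟩ := Complex.exists_half_plane hx
  have h := eval_aeval_derivative_ne_zero (a := 0) hxu hQ0 hQ (f := P) (fun y hy h0 => by
    obtain ⟨h1, h2⟩ := hP y h0
    rw [Complex.mul_re, h1, Complex.conj_re] at hy
    nlinarith) 0 (by simp)
  rw [aeval_smul_derivative_apply _ _ _ (Nat.lt_succ_self _), eval_finsetSum] at h
  convert h using 2 with k
  rw [eval_smul, ← coeff_zero_eq_eval_zero, coeff_iterate_derivative, zero_add,
    Nat.descFactorial_self, smul_eq_mul, nsmul_eq_mul]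
  ring

theorem sum_coeff_ne_zero_of_factorial {R : ℂ[X]} (hR0 : R ≠ 0)
    (hR : ∀ z, R.eval z = 0 → z.im = 0 ∧ z.re < 0) {x : ℂ} (hx : x ∈ Complex.slitPlane) :
    ∑ k ∈ Finset.range (R.natDegree + 1), R.coeff k / (k.factorial : ℂ) * x ^ k ≠ 0 := by
  obtain ⟨u, hu, hxu⟩ := Complex.exists_half_plane hx
  have hrev : ∀ z, R.reverse.eval z = 0 → z.im = 0 ∧ z.re < 0 := by
    intro z hz
    have hz0 : z ≠ 0 := by
      rintro rfl
      rw [← coeff_zero_eq_eval_zero, coeff_zero_reverse] at hz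
      exact leadingCoeff_ne_zero.2 hR0 hz
    have h1 : R.eval z⁻¹ = 0 := by
      let _ := invertibleOfNonzero (inv_ne_zero hz0)
      have := eval₂_reverse_mul_pow (RingHom.id ℂ) z⁻¹ R
      rw [invOf_eq_inv, inv_inv] at this
      rw [eval₂_id, eval₂_id, hz, zero_mul] at this
      exact this.symm
    obtain ⟨h2, h3⟩ := hR _ h1
    have hn := Complex.normSq_pos.2 hz0
    rw [Complex.inv_im, div_eq_zero_iff] at h2
    rw [Complex.inv_re] at h3
    refine ⟨by rcases h2 with h2 | h2 <;> linarith, ?_⟩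
    by_contra hcon
    exact absurd h3 (not_lt.2 (div_nonneg (not_lt.1 hcon) hn.le))
  have h := eval_aeval_derivative_ne_zero (u := u) (s := 1) (a := (x * conj u).re) (by simpa)
    (by simpa using hR0) hrev (f := X ^ R.natDegree) (fun y hy h0 => by
      have : y = 0 := by
        rw [eval_pow, eval_X] at h0
        by_contra hy0
        exact pow_ne_zero _ hy0 h0
      rw [this] at hy
      simp at hy
      simp at hxu
      linarith) x le_rfl
  rw [aeval_smul_derivative_apply _ _ _ (Nat.lt_succ_of_le R.reverse_natDegree_le),
    eval_finsetSum, ← Finset.sum_range_reflect] at h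
  have hd : (R.natDegree.factorial : ℂ) ≠ 0 := Nat.cast_ne_zero.2 (Nat.factorial_ne_zero _)
  refine right_ne_zero_of_mul (a := (R.natDegree.factorial : ℂ)) ?_
  rw [Finset.mul_sum]
  convert h using 1
  refine Finset.sum_congr rfl fun k hk => ?_
  have hk' : k ≤ R.natDegree := Nat.lt_succ_iff.1 (Finset.mem_range.1 hk)
  have hk2 : R.natDegree + 1 - 1 - k = R.natDegree - k := by omega
  have hfac : (k.factorial : ℂ) ≠ 0 := Nat.cast_ne_zero.2 (Nat.factorial_ne_zero _)
  have hdf := Nat.factorial_mul_descFactorial (Nat.sub_le R.natDegree k)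
  rw [Nat.sub_sub_self hk'] at hdf
  rw [hk2, coeff_reverse, revAt_le (Nat.sub_le _ _), Nat.sub_sub_self hk',
    iterate_derivative_X_pow_eq_smul, Nat.sub_sub_self hk', eval_smul, eval_smul, eval_pow, eval_X,
    one_pow, mul_one, ← hdf]
  simp only [smul_eq_mul, Nat.cast_mul]
  field_simp

theorem coeff_hadamardProduct (n : ℕ) (P Q : ℝ[X]) (k : ℕ) :
    (hadamardProduct n P Q).coeff k = if k ≤ n then P.coeff k * Q.coeff k else 0 := by
  simp [hadamardProduct, finsetSum_coeff, coeff_monomial, Finset.sum_ite_eq']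

theorem natDegree_hadamardProduct_le (n : ℕ) (P Q : ℝ[X]) :
    (hadamardProduct n P Q).natDegree ≤ n := by
  refine natDegree_le_iff_coeff_eq_zero.2 fun k hk => ?_
  rw [coeff_hadamardProduct, if_neg (not_le.2 hk)]

theorem coeff_hadamardProduct_of_natDegree_le {n : ℕ} {P : ℝ[X]} (h : P.natDegree ≤ n) (Q : ℝ[X])
    (k : ℕ) : (hadamardProduct n P Q).coeff k = P.coeff k * Q.coeff k := by
  rw [coeff_hadamardProduct]
  split_ifs with hk
  · rfl
  · rw [coeff_eq_zero_of_natDegree_lt (by omega), zero_mul]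

theorem sum_coeff_mul_coeff_ne_zero {P Q : ℂ[X]} (hP : ∀ z, P.eval z = 0 → z.im = 0 ∧ z.re < 0)
    (hQ : ∀ z, Q.eval z = 0 → z.im = 0 ∧ z.re < 0) {n : ℕ} (hn : Q.natDegree ≤ n) {x : ℂ}
    (hx : x ∈ Complex.slitPlane) :
    ∑ k ∈ Finset.range (n + 1), P.coeff k * Q.coeff k * x ^ k ≠ 0 := by
  have hQ0 : Q ≠ 0 := by
    rintro rfl; have := hQ 0 (by simp); simp at this
  set R : ℂ[X] := ∑ k ∈ Finset.range (Q.natDegree + 1),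
    monomial k ((k.factorial : ℂ) * (P.coeff k * Q.coeff k)) with hRdef
  have hc : ∀ k, R.coeff k = (k.factorial : ℂ) * (P.coeff k * Q.coeff k) := by
    intro k
    simp only [hRdef, finsetSum_coeff, coeff_monomial, Finset.sum_ite_eq', Finset.mem_range]
    split_ifs with h
    · rfl
    · rw [coeff_eq_zero_of_natDegree_lt (p := Q) (by omega), mul_zero, mul_zero]
  have hReval : ∀ z, R.eval z = ∑ k ∈ Finset.range (Q.natDegree + 1),
      (k.factorial : ℂ) * (P.coeff k * Q.coeff k) * z ^ k := by
    intro z; simp [hRdef, eval_finsetSum]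
  have hR00 : R.coeff 0 ≠ 0 := by
    rw [hc]
    have h1 : P.coeff 0 ≠ 0 := fun h => by
      rw [coeff_zero_eq_eval_zero] at h; simpa using (hP 0 h).2
    have h2 : Q.coeff 0 ≠ 0 := fun h => by
      rw [coeff_zero_eq_eval_zero] at h; simpa using (hQ 0 h).2
    simp [h1, h2]
  have hR0 : R ≠ 0 := by rintro h; simp [h] at hR00
  have hR : ∀ z, R.eval z = 0 → z.im = 0 ∧ z.re < 0 := by
    intro z hz
    have h1 : z ∉ Complex.slitPlane := fun hzs =>
      sum_factorial_mul_coeff_ne_zero hP hQ0 hQ hzs (by rw [← hReval, hz])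
    rw [Complex.mem_slitPlane_iff] at h1
    push Not at h1
    refine ⟨h1.2, h1.1.lt_of_ne fun h0 => hR00 ?_⟩
    have hz0 : z = 0 := Complex.ext h0 h1.2
    rw [hz0] at hz
    rwa [coeff_zero_eq_eval_zero]
  have h := sum_coeff_ne_zero_of_factorial hR0 hR hx
  have hdeg : R.natDegree + 1 ≤ n + 1 := by
    refine Nat.succ_le_succ (natDegree_le_iff_coeff_eq_zero.2 fun k hk => ?_)
    rw [hc, coeff_eq_zero_of_natDegree_lt (p := Q) (by omega), mul_zero, mul_zero]
  rw [Finset.sum_subset (Finset.range_mono hdeg) (fun k _ hk => by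
    rw [coeff_eq_zero_of_natDegree_lt (by simpa using hk), zero_div, zero_mul])] at h
  convert h using 3 with k
  rw [hc, mul_div_cancel_left₀]
  exact Nat.cast_ne_zero.2 (Nat.factorial_ne_zero _)

theorem HasNonposRoots.eval_map_taylor {P : ℝ[X]} (h : HasNonposRoots P) {ε : ℝ} (hε : 0 < ε)
    (z : ℂ) (hz : ((taylor ε P).map (algebraMap ℝ ℂ)).eval z = 0) : z.im = 0 ∧ z.re < 0 := by
  rw [map_taylor, taylor_eval, eval_map_algebraMap] at hz
  obtain ⟨h1, h2⟩ := h.2 _ hz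
  simp at h1 h2
  exact ⟨h1, by linarith⟩

theorem aeval_hadamardProduct (n : ℕ) (P Q : ℝ[X]) (x : ℂ) :
    aeval x (hadamardProduct n P Q) =
      ∑ k ∈ Finset.range (n + 1), (P.coeff k : ℂ) * (Q.coeff k : ℂ) * x ^ k := by
  rw [hadamardProduct, map_sum]
  refine Finset.sum_congr rfl fun k _ => ?_
  rw [aeval_monomial]; simp

theorem HasNonposRoots.hadamardProduct_taylor {P Q : ℝ[X]} (hP : HasNonposRoots P)
    (hQ : HasNonposRoots Q) {n : ℕ} (hn : Q.natDegree ≤ n) {ε : ℝ} (hε : 0 < ε) :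
    HasNonposRoots (hadamardProduct n (taylor ε P) (taylor ε Q)) := by
  have key : ∀ x ∈ Complex.slitPlane,
      aeval x (hadamardProduct n (taylor ε P) (taylor ε Q)) ≠ 0 := by
    intro x hx
    have := sum_coeff_mul_coeff_ne_zero (hP.eval_map_taylor hε) (hQ.eval_map_taylor hε)
      (n := n) (by rwa [natDegree_map, natDegree_taylor]) hx
    rw [aeval_hadamardProduct]
    simp only [coeff_map] at this
    exact this
  refine hasNonposRoots_iff.2 ⟨fun h0 => key 1 Complex.one_mem_slitPlane ?_, key⟩
  rw [h0, map_zero]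

theorem HasNonposRoots.le_norm_aeval {P : ℝ[X]} (h : HasNonposRoots P) {x : ℂ} {δ : ℝ}
    (hδ : 0 ≤ δ) (hx : ∀ z ∉ Complex.slitPlane, δ ≤ ‖x - z‖) :
    |P.leadingCoeff| * δ ^ P.natDegree ≤ ‖aeval x P‖ := by
  have key : ∀ m : Multiset ℂ, (∀ z ∈ m, z ∉ Complex.slitPlane) →
      δ ^ m.card ≤ ‖(m.map fun z => x - z).prod‖ := by
    intro m
    induction m using Multiset.induction_on with
    | empty => simp
    | cons z m ih =>
      intro hm
      rw [Multiset.card_cons, Multiset.map_cons, Multiset.prod_cons, norm_mul, pow_succ']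
      exact mul_le_mul (hx z (hm z (Multiset.mem_cons_self z m)))
        (ih fun y hy => hm y (Multiset.mem_cons_of_mem hy)) (pow_nonneg hδ _) (norm_nonneg _)
  have hs := IsAlgClosed.splits (P.map (algebraMap ℝ ℂ))
  have h1 := key (P.map (algebraMap ℝ ℂ)).roots fun z hz hzs => by
    have := (mem_roots'.1 hz).2
    rw [IsRoot, eval_map_algebraMap] at this
    exact (hasNonposRoots_iff.1 h).2 z hzs this
  rw [← hs.natDegree_eq_card_roots, natDegree_map] at h1
  rw [← eval_map_algebraMap, hs.eval_eq_prod_roots, norm_mul, leadingCoeff_map]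
  simpa using mul_le_mul_of_nonneg_left h1 (abs_nonneg P.leadingCoeff)

/-- A limit of polynomials with nonpositive roots has nonpositive roots if the leading coefficient
does not degenerate. -/
theorem HasNonposRoots.of_tendsto {ι : Type*} {l : Filter ι} [l.NeBot] {S : ι → ℝ[X]} {T : ℝ[X]}
    {d : ℕ} (hS : ∀ᶠ i in l, HasNonposRoots (S i)) (hd : ∀ i, (S i).natDegree ≤ d)
    (hT : T.natDegree ≤ d) (hlim : ∀ k, Tendsto (fun i => (S i).coeff k) l (𝓝 (T.coeff k)))
    (hTd : T.coeff d ≠ 0) : HasNonposRoots T := by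
  refine hasNonposRoots_iff.2 ⟨by rintro rfl; simp at hTd, fun x hx h0 => ?_⟩
  obtain ⟨δ, hδ, hball⟩ := Metric.isOpen_iff.1 Complex.isOpen_slitPlane x hx
  have hx' : ∀ z ∉ Complex.slitPlane, δ ≤ ‖x - z‖ := by
    intro z hz
    by_contra hc
    exact hz (hball (by rw [Metric.mem_ball, dist_comm, dist_eq_norm]; exact not_le.1 hc))
  have hev : Tendsto (fun i => ‖aeval x (S i)‖) l (𝓝 ‖aeval x T‖) := by
    refine Tendsto.norm ?_
    have : ∀ p : ℝ[X], p.natDegree ≤ d →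
        aeval x p = ∑ k ∈ Finset.range (d + 1), (p.coeff k : ℂ) * x ^ k := fun p hp => by
      rw [aeval_eq_sum_range' (Nat.lt_succ_of_le hp)]
      simp
    simp only [this _ (hd _), this _ hT]
    exact tendsto_finsetSum _ fun k _ =>
      ((Complex.continuous_ofReal.tendsto _).comp (hlim k)).mul_const _
  have hlow : Tendsto (fun i => |(S i).coeff d| * δ ^ d) l (𝓝 (|T.coeff d| * δ ^ d)) :=
    (hlim d).abs.mul_const _
  have hle : |T.coeff d| * δ ^ d ≤ ‖aeval x T‖ := by
    refine le_of_tendsto_of_tendsto hlow hev ?_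
    filter_upwards [hS, (hlim d).eventually_ne hTd] with i hi hne
    have hdeg : (S i).natDegree = d := le_antisymm (hd i) (le_natDegree_of_ne_zero hne)
    have := hi.le_norm_aeval hδ.le hx'
    rwa [leadingCoeff, hdeg] at this
  rw [h0, norm_zero] at hle
  exact absurd hle (not_le.2 (mul_pos (abs_pos.2 hTd) (pow_pos hδ d)))

/-- A theorem of Malo: Hadamard products preserve nonpositivity of the roots. -/
theorem HasNonposRoots.hadamardProduct {P Q : ℝ[X]} (hP : HasNonposRoots P)
    (hQ : HasNonposRoots Q) {n : ℕ} (hPn : P.natDegree ≤ n) (hQn : Q.natDegree ≤ n)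
    (h0 : hadamardProduct n P Q ≠ 0) : HasNonposRoots (hadamardProduct n P Q) := by
  obtain ⟨k, hk⟩ : ∃ k, (_root_.hadamardProduct n P Q).coeff k ≠ 0 := by
    by_contra hc
    push Not at hc
    exact h0 (Polynomial.ext fun k => by simp [hc k])
  rw [coeff_hadamardProduct_of_natDegree_le hPn] at hk
  have hkP := left_ne_zero_of_mul hk
  have hkQ := right_ne_zero_of_mul hk
  have hkP' := le_natDegree_of_ne_zero hkP
  have hkQ' := le_natDegree_of_ne_zero hkQ
  set d := min P.natDegree Q.natDegree with hd
  have hdeg : ∀ p q : ℝ[X], p.natDegree = P.natDegree → q.natDegree = Q.natDegree →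
      (_root_.hadamardProduct n p q).natDegree ≤ d := by
    intro p q hp hq
    refine natDegree_le_iff_coeff_eq_zero.2 fun j hj => ?_
    rw [coeff_hadamardProduct_of_natDegree_le (hp ▸ hPn), mul_eq_zero]
    rcases min_lt_iff.1 hj with h | h
    · exact Or.inl (coeff_eq_zero_of_natDegree_lt (by omega))
    · exact Or.inr (coeff_eq_zero_of_natDegree_lt (by omega))
  have hcoeff : ∀ (p : ℝ[X]) k,
      Tendsto (fun ε : ℝ => (taylor ε p).coeff k) (𝓝[>] 0) (𝓝 (p.coeff k)) := by
    intro p k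
    have : ContinuousAt (fun ε : ℝ => (taylor ε p).coeff k) 0 := by
      simp only [taylor_coeff]; exact (Polynomial.continuous _).continuousAt
    simpa [ContinuousAt] using this.tendsto.mono_left nhdsWithin_le_nhds
  refine HasNonposRoots.of_tendsto (l := 𝓝[>] (0 : ℝ)) (d := d)
    (S := fun ε => _root_.hadamardProduct n (taylor ε P) (taylor ε Q)) ?_
    (fun ε => hdeg _ _ (natDegree_taylor _ _) (natDegree_taylor _ _)) (hdeg _ _ rfl rfl) ?_ ?_
  · filter_upwards [self_mem_nhdsWithin] with ε hε
    exact hP.hadamardProduct_taylor hQ hQn hε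
  · intro k
    simp only [coeff_hadamardProduct]
    split_ifs
    · exact (hcoeff P k).mul (hcoeff Q k)
    · exact tendsto_const_nhds
  · rw [coeff_hadamardProduct_of_natDegree_le hPn]
    refine mul_ne_zero (hP.coeff_ne_zero hkP (leadingCoeff_ne_zero.2 hP.1) (by omega) (by omega))
      (hQ.coeff_ne_zero hkQ (leadingCoeff_ne_zero.2 hQ.1) (by omega) (by omega))

/-! ### The logarithmic derivative as a mean -/

theorem sum_mul_le_of_geometric {q : ℕ → ℝ} {r : ℝ} (hr : 0 ≤ r) (N : ℕ) (hq0 : ∀ i, 0 ≤ q i)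
    (hq : ∀ i, i + 1 < N → q (i + 1) ≤ r * q i) :
    (1 - r) * ∑ i ∈ Finset.range N, (i : ℝ) * q i ≤ r * ∑ i ∈ Finset.range N, q i := by
  cases N with
  | zero => simp
  | succ M =>
    have h1 : ∑ i ∈ Finset.range (M + 1), (i : ℝ) * q i ≤
        r * ∑ i ∈ Finset.range (M + 1), ((i : ℝ) + 1) * q i := by
      rw [Finset.sum_range_succ', Finset.mul_sum, Finset.sum_range_succ]
      have h2 : ∑ i ∈ Finset.range M, ((i + 1 : ℕ) : ℝ) * q (i + 1) ≤
          ∑ i ∈ Finset.range M, r * (((i : ℝ) + 1) * q i) := by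
        refine Finset.sum_le_sum fun i hi => ?_
        have := hq i (by have := Finset.mem_range.1 hi; omega)
        push_cast
        have h0 : (0 : ℝ) ≤ (i : ℝ) + 1 := by positivity
        nlinarith [mul_le_mul_of_nonneg_left this h0]
      have h3 : 0 ≤ r * (((M : ℝ) + 1) * q M) :=
        mul_nonneg hr (mul_nonneg (by positivity) (hq0 M))
      simp only [Nat.cast_zero, zero_mul, add_zero]
      linarith
    simp only [add_mul, one_mul, Finset.sum_add_distrib] at h1
    linarith

theorem IsLogConcave.le_sum_mul {p : ℕ → ℝ} (hp : IsLogConcave p) {N k : ℕ}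
    (hN : ∀ j, N ≤ j → p j = 0) {r : ℝ} (hr : 0 ≤ r) (hr1 : r < 1) (hk : p k ≤ r * p (k + 1))
    (hk1 : p (k + 1) ≠ 0) :
    ((k : ℝ) + 1 - r / (1 - r)) * ∑ j ∈ Finset.range N, p j ≤
      ∑ j ∈ Finset.range N, (j : ℝ) * p j := by
  have hpos := (hp.nonneg (k + 1)).lt_of_ne' hk1
  have hkN : k + 2 ≤ N := by
    by_contra hc; exact hk1 (hN _ (by omega))
  have h1 := sum_mul_le_of_geometric (q := fun i => p (k + 1 - i)) hr (k + 2)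
    (fun i => hp.nonneg _) (fun i hi => by
      have h := hp.mul_le (k + 1 - (i + 1)) k (by omega)
      have h2 : k + 1 - (i + 1) + 1 = k + 1 - i := by omega
      rw [h2] at h
      have h3 := mul_le_mul_of_nonneg_left hk (hp.nonneg (k + 1 - i))
      refine le_of_mul_le_mul_right ?_ hpos
      linarith)
  have h2 : ∑ i ∈ Finset.range (k + 2), p (k + 1 - i) = ∑ j ∈ Finset.range (k + 2), p j :=
    Finset.sum_range_reflect p (k + 2)
  have h3 : ∑ i ∈ Finset.range (k + 2), (i : ℝ) * p (k + 1 - i) =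
      ∑ j ∈ Finset.range (k + 2), ((k : ℝ) + 1 - j) * p j := by
    rw [← Finset.sum_range_reflect]
    refine Finset.sum_congr rfl fun j hj => ?_
    have hj' := Finset.mem_range.1 hj
    have e1 : k + 2 - 1 - j = k + 1 - j := by omega
    have e2 : k + 1 - (k + 1 - j) = j := by omega
    rw [e1, e2, Nat.cast_sub (by omega)]
    push_cast; ring
  have h4 : ∑ j ∈ Finset.range N, ((k : ℝ) + 1 - j) * p j ≤
      ∑ j ∈ Finset.range (k + 2), ((k : ℝ) + 1 - j) * p j := by
    rw [← Finset.sum_range_add_sum_Ico _ hkN]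
    refine add_le_of_nonpos_right (Finset.sum_nonpos fun j hj => ?_)
    have hj' : ((k + 2 : ℕ) : ℝ) ≤ j := Nat.cast_le.2 (Finset.mem_Ico.1 hj).1
    push_cast at hj'
    exact mul_nonpos_of_nonpos_of_nonneg (by linarith) (hp.nonneg j)
  have h5 : ∑ j ∈ Finset.range (k + 2), p j ≤ ∑ j ∈ Finset.range N, p j :=
    Finset.sum_le_sum_of_subset_of_nonneg (Finset.range_mono hkN) fun j _ _ => hp.nonneg j
  rw [h2, h3] at h1
  have h6 : ∑ j ∈ Finset.range (k + 2), ((k : ℝ) + 1 - j) * p j ≤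
      r / (1 - r) * ∑ j ∈ Finset.range N, p j := by
    rw [div_mul_eq_mul_div, le_div_iff₀ (by linarith)]
    nlinarith [mul_le_mul_of_nonneg_left h5 hr]
  have h7 := h4.trans h6
  simp only [sub_mul, Finset.sum_sub_distrib, ← Finset.mul_sum] at h7 ⊢
  linarith

theorem IsLogConcave.sum_mul_le {p : ℕ → ℝ} (hp : IsLogConcave p) {N k : ℕ}
    (hN : ∀ j, N ≤ j → p j = 0) {r : ℝ} (hr : 0 ≤ r) (hr1 : r < 1) (hk : p (k + 1) ≤ r * p k)
    (hk1 : p k ≠ 0) :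
    ∑ j ∈ Finset.range N, (j : ℝ) * p j ≤
      ((k : ℝ) + r / (1 - r)) * ∑ j ∈ Finset.range N, p j := by
  have hpos := (hp.nonneg k).lt_of_ne' hk1
  obtain ⟨M, rfl⟩ : ∃ M, N = k + M := by
    refine ⟨N - k, ?_⟩
    by_contra hc; exact hk1 (hN _ (by omega))
  have h1 := sum_mul_le_of_geometric (q := fun i => p (k + i)) hr M
    (fun i => hp.nonneg _) (fun i hi => by
      have h := hp.mul_le k (k + i) (by omega)
      have h3 := mul_le_mul_of_nonneg_right hk (hp.nonneg (k + i))
      refine le_of_mul_le_mul_left ?_ hpos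
      rw [← add_assoc]
      linarith)
  have h2 : ∑ j ∈ Finset.range k, (j : ℝ) * p j ≤ k * ∑ j ∈ Finset.range k, p j := by
    rw [Finset.mul_sum]
    refine Finset.sum_le_sum fun j hj => mul_le_mul_of_nonneg_right ?_ (hp.nonneg j)
    exact_mod_cast (Finset.mem_range.1 hj).le
  have h3 : 0 ≤ ∑ j ∈ Finset.range k, p j := Finset.sum_nonneg fun j _ => hp.nonneg j
  rw [Finset.sum_range_add, Finset.sum_range_add]
  simp only [Nat.cast_add, add_mul, Finset.sum_add_distrib, ← Finset.mul_sum]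
  have h4 : ∑ i ∈ Finset.range M, (i : ℝ) * p (k + i) ≤
      r / (1 - r) * ∑ i ∈ Finset.range M, p (k + i) := by
    rw [div_mul_eq_mul_div, le_div_iff₀ (by linarith)]
    linarith
  have h5 : 0 ≤ r / (1 - r) := div_nonneg hr (by linarith)
  nlinarith [mul_nonneg h5 h3]

theorem HasNonposRoots.eval_ne_zero {P : ℝ[X]} (h : HasNonposRoots P) {t : ℝ} (ht : 0 < t) :
    P.eval t ≠ 0 := fun h0 =>
  absurd (h.nonpos_of_mem_roots ((mem_roots h.1).2 h0)) (not_le.2 ht)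

theorem HasNonposRoots.exists_weights {P : ℝ[X]} (h : HasNonposRoots P) {t : ℝ} (ht : 0 < t) :
    ∃ c, c ≠ 0 ∧ IsLogConcave (fun k => c * P.coeff k * t ^ k) ∧
      (∑ j ∈ Finset.range (P.natDegree + 1), c * P.coeff j * t ^ j = c * P.eval t) ∧
      0 < c * P.eval t ∧
      ∑ j ∈ Finset.range (P.natDegree + 1), (j : ℝ) * (c * P.coeff j * t ^ j) =
        t * P.derivative.eval t / P.eval t * (c * P.eval t) := by
  have hl : P.leadingCoeff⁻¹ ≠ 0 := inv_ne_zero (leadingCoeff_ne_zero.2 h.1)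
  have hlc := h.isLogConcave.mul_pow ht.le
  have hsum : ∑ j ∈ Finset.range (P.natDegree + 1), P.leadingCoeff⁻¹ * P.coeff j * t ^ j =
      P.leadingCoeff⁻¹ * P.eval t := by
    rw [eval_eq_sum_range, Finset.mul_sum]
    exact Finset.sum_congr rfl fun j _ => mul_assoc _ _ _
  have hne := h.eval_ne_zero ht
  refine ⟨P.leadingCoeff⁻¹, hl, hlc, hsum, lt_of_le_of_ne ?_ (mul_ne_zero hl hne).symm, ?_⟩
  · rw [← hsum]; exact Finset.sum_nonneg fun j _ => hlc.nonneg j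
  · have hd : t * P.derivative.eval t =
        ∑ j ∈ Finset.range (P.natDegree + 1), (j : ℝ) * (P.coeff j * t ^ j) := by
      rw [derivative_eval, sum_over_range _ (by simp), Finset.mul_sum]
      refine Finset.sum_congr rfl fun j _ => ?_
      cases j with
      | zero => simp
      | succ j => rw [Nat.add_sub_cancel]; ring
    have : t * P.derivative.eval t / P.eval t * (P.leadingCoeff⁻¹ * P.eval t) =
        P.leadingCoeff⁻¹ * (t * P.derivative.eval t) := by field_simp
    rw [this, hd, Finset.mul_sum]
    exact Finset.sum_congr rfl fun j _ => by ring

theorem HasNonposRoots.le_mean {P : ℝ[X]} (h : HasNonposRoots P) {t r : ℝ} (ht : 0 < t)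
    (hr : 0 ≤ r) (hr1 : r < 1) {k : ℕ} (hk1 : P.coeff (k + 1) ≠ 0)
    (hk : P.coeff k / P.coeff (k + 1) ≤ r * t) :
    (k : ℝ) + 1 - r / (1 - r) ≤ t * P.derivative.eval t / P.eval t := by
  obtain ⟨c, hc, hlc, hs, hpos, hm⟩ := h.exists_weights ht
  have h1 := hlc.le_sum_mul (N := P.natDegree + 1) (k := k)
    (fun j hj => by simp [coeff_eq_zero_of_natDegree_lt (Nat.lt_of_succ_le hj)]) hr hr1 (by
      have h2 : 0 ≤ c * P.coeff (k + 1) * t ^ (k + 1) := hlc.nonneg (k + 1)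
      have h3 := mul_le_mul_of_nonneg_left hk h2
      have h4 : c * P.coeff (k + 1) * t ^ (k + 1) * (P.coeff k / P.coeff (k + 1)) =
        c * P.coeff k * t ^ k * t := by field_simp; ring
      rw [h4] at h3
      refine le_of_mul_le_mul_right ?_ ht
      simpa [mul_assoc, mul_comm, mul_left_comm] using h3)
    (mul_ne_zero (mul_ne_zero hc hk1) (pow_ne_zero _ ht.ne'))
  rw [hs, hm] at h1
  exact le_of_mul_le_mul_right h1 hpos

theorem HasNonposRoots.mean_le {P : ℝ[X]} (h : HasNonposRoots P) {t r : ℝ} (ht : 0 < t)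
    (hr : 0 ≤ r) (hr1 : r < 1) {k : ℕ} (hk0 : P.coeff k ≠ 0) (hk1 : P.coeff (k + 1) ≠ 0)
    (hk : t ≤ r * (P.coeff k / P.coeff (k + 1))) :
    t * P.derivative.eval t / P.eval t ≤ (k : ℝ) + r / (1 - r) := by
  obtain ⟨c, hc, hlc, hs, hpos, hm⟩ := h.exists_weights ht
  have h1 := hlc.sum_mul_le (N := P.natDegree + 1) (k := k)
    (fun j hj => by simp [coeff_eq_zero_of_natDegree_lt (Nat.lt_of_succ_le hj)]) hr hr1 (by
      have h2 : 0 ≤ c * P.coeff (k + 1) * t ^ (k + 1) := hlc.nonneg (k + 1)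
      have h3 := mul_le_mul_of_nonneg_left hk h2
      have h4 : c * P.coeff (k + 1) * t ^ (k + 1) * (r * (P.coeff k / P.coeff (k + 1))) =
        r * (c * P.coeff k * t ^ k) * t := by field_simp; ring
      rw [h4] at h3
      exact le_of_mul_le_mul_right h3 ht)
    (mul_ne_zero (mul_ne_zero hc hk0) (pow_ne_zero _ ht.ne'))
  rw [hs, hm] at h1
  exact le_of_mul_le_mul_right h1 hpos

theorem HasNonposRoots.exists_coeff_ne_zero_lt {P : ℝ[X]} (h : HasNonposRoots P) {t : ℝ}
    (ht : 0 < t) {k : ℕ} (hk : t * P.derivative.eval t / P.eval t < k) :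
    ∃ j < k, P.coeff j ≠ 0 := by
  by_contra! hcon
  obtain ⟨c, hc, hlc, hs, hpos, hm⟩ := h.exists_weights ht
  have : k * (c * P.eval t) ≤ t * P.derivative.eval t / P.eval t * (c * P.eval t) := by
    rw [← hm, ← hs, Finset.mul_sum]
    refine Finset.sum_le_sum fun j _ => ?_
    rcases lt_or_ge j k with hj | hj
    · simp [hcon j hj]
    · exact mul_le_mul_of_nonneg_right (by exact_mod_cast hj) (hlc.nonneg j)
  exact absurd (le_of_mul_le_mul_right this hpos) (not_le.2 hk)

theorem HasNonposRoots.exists_lt_coeff_ne_zero {P : ℝ[X]} (h : HasNonposRoots P) {t : ℝ}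
    (ht : 0 < t) {k : ℕ} (hk : k < t * P.derivative.eval t / P.eval t) :
    ∃ j > k, P.coeff j ≠ 0 := by
  by_contra! hcon
  obtain ⟨c, hc, hlc, hs, hpos, hm⟩ := h.exists_weights ht
  have : t * P.derivative.eval t / P.eval t * (c * P.eval t) ≤ k * (c * P.eval t) := by
    rw [← hm, ← hs, Finset.mul_sum]
    refine Finset.sum_le_sum fun j _ => ?_
    rcases lt_or_ge k j with hj | hj
    · simp [hcon j hj]
    · exact mul_le_mul_of_nonneg_right (by exact_mod_cast hj) (hlc.nonneg j)
  exact absurd (le_of_mul_le_mul_right this hpos) (not_le.2 hk)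

/-! ### The kernel `t / (t - z)` on `[-∞, 0]` -/

/-- The function `z ↦ t / (t - z)` on `[-∞, 0]`, extended by the constant `1` to `[0, ∞]`. -/
noncomputable def cauchyKernel (t : ℝ) (z : EReal) : ℝ :=
  t * ((ENNReal.ofReal t + (-z).toENNReal)⁻¹).toReal

theorem cauchyKernel_bot (t : ℝ) : cauchyKernel t ⊥ = 0 := by
  simp [cauchyKernel]

theorem cauchyKernel_coe {t r : ℝ} (ht : 0 < t) (hr : r ≤ 0) :
    cauchyKernel t (r : EReal) = t / (t - r) := by
  rw [cauchyKernel, ← EReal.coe_neg, EReal.toENNReal_of_ne_top (EReal.coe_ne_top _),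
    EReal.toReal_coe, ← ENNReal.ofReal_add ht.le (by linarith), ENNReal.toReal_inv,
    ENNReal.toReal_ofReal (by linarith), div_eq_mul_inv, sub_eq_add_neg]

theorem continuous_cauchyKernel {t : ℝ} (ht : 0 < t) : Continuous (cauchyKernel t) := by
  refine continuous_const.mul ?_
  refine ENNReal.continuousOn_toReal.comp_continuous ?_ fun z => ?_
  · exact (continuous_const.add (EReal.continuous_toENNReal.comp continuous_neg)).inv
  · simp [ht]

/-- Elements of `[-∞, 0]` are `-∞` or nonpositive real numbers. -/
theorem EReal.eq_bot_or_coe_of_nonpos {z : EReal} (hz : z ≤ 0) :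
    z = ⊥ ∨ ∃ r : ℝ, r ≤ 0 ∧ z = r := by
  induction z with
  | bot => exact Or.inl rfl
  | coe r => exact Or.inr ⟨r, by exact_mod_cast hz, rfl⟩
  | top => simp at hz

theorem cauchyKernel_nonneg {t : ℝ} (ht : 0 < t) (z : EReal) : 0 ≤ cauchyKernel t z :=
  mul_nonneg ht.le ENNReal.toReal_nonneg

theorem cauchyKernel_le_one {t : ℝ} (ht : 0 < t) {z : EReal} (hz : z ≤ 0) :
    cauchyKernel t z ≤ 1 := by
  obtain rfl | ⟨r, hr, rfl⟩ := EReal.eq_bot_or_coe_of_nonpos hz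
  · rw [cauchyKernel_bot]; exact zero_le_one
  · rw [cauchyKernel_coe ht hr, div_le_one (by linarith)]; linarith

theorem cauchyKernel_mul {s t : ℝ} (hs : 0 < s) (ht : 0 < t) (hst : s ≠ t) {z : EReal}
    (hz : z ≤ 0) :
    cauchyKernel s z * cauchyKernel t z =
      t / (t - s) * cauchyKernel s z - s / (t - s) * cauchyKernel t z := by
  obtain rfl | ⟨r, hr, rfl⟩ := EReal.eq_bot_or_coe_of_nonpos hz
  · simp [cauchyKernel_bot]
  · rw [cauchyKernel_coe hs hr, cauchyKernel_coe ht hr]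
    have h1 : s - r ≠ 0 := by linarith
    have h2 : t - r ≠ 0 := by linarith
    have h3 : t - s ≠ 0 := sub_ne_zero.2 hst.symm
    field_simp
    ring

theorem abs_cauchyKernel_sub_le {s t : ℝ} (hs : 0 < s) (ht : 0 < t) {z : EReal} (hz : z ≤ 0) :
    |cauchyKernel s z - cauchyKernel t z| ≤ |s - t| / t := by
  obtain rfl | ⟨r, hr, rfl⟩ := EReal.eq_bot_or_coe_of_nonpos hz
  · simp [cauchyKernel_bot]; positivity
  · rw [cauchyKernel_coe hs hr, cauchyKernel_coe ht hr]
    have h1 : 0 < s - r := by linarith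
    have h2 : 0 < t - r := by linarith
    have : s / (s - r) - t / (t - r) = (s - t) * (-r / ((s - r) * (t - r))) := by
      field_simp; ring
    rw [this, abs_mul, div_eq_mul_inv |s - t|]
    refine mul_le_mul_of_nonneg_left ?_ (abs_nonneg _)
    rw [abs_of_nonneg (div_nonneg (by linarith) (by positivity)), div_le_iff₀ (by positivity),
      ← div_eq_inv_mul, le_div_iff₀ ht]
    nlinarith [mul_pos hs ht, mul_nonneg hs.le (neg_nonneg.2 hr), mul_nonneg_of_nonpos_of_nonpos hr hr]

theorem cauchyKernel_lt {s t : ℝ} (hs : 0 < s) (hst : s < t) {z : EReal} (hz : z < 0)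
    (hz' : z ≠ ⊥) : cauchyKernel s z < cauchyKernel t z := by
  obtain rfl | ⟨r, hr, rfl⟩ := EReal.eq_bot_or_coe_of_nonpos hz.le
  · exact absurd rfl hz'
  · have hr' : r < 0 := by exact_mod_cast hz
    rw [cauchyKernel_coe hs hr, cauchyKernel_coe (hs.trans hst) hr,
      div_lt_div_iff₀ (by linarith) (by linarith)]
    nlinarith

theorem cauchyKernel_mono {s t : ℝ} (hs : 0 < s) (hst : s ≤ t) {z : EReal} (hz : z ≤ 0) :
    cauchyKernel s z ≤ cauchyKernel t z := by
  rcases hst.eq_or_lt with rfl | hst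
  · exact le_rfl
  rcases eq_or_ne z ⊥ with rfl | hb
  · simp [cauchyKernel_bot]
  rcases hz.eq_or_lt with rfl | hz
  · have : ((0 : ℝ) : EReal) = 0 := rfl
    rw [← this, cauchyKernel_coe hs le_rfl, cauchyKernel_coe (hs.trans hst) le_rfl, sub_zero,
      sub_zero, div_self hs.ne', div_self (hs.trans hst).ne']
  · exact (cauchyKernel_lt hs hst hz hb).le

theorem integrable_cauchyKernel {t : ℝ} (ht : 0 < t) (μ : Measure EReal) [IsFiniteMeasure μ] :
    Integrable (cauchyKernel t) μ :=
  (BoundedContinuousFunction.mkOfCompact ⟨_, continuous_cauchyKernel ht⟩).integrable μ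

theorem tCauchy_eq_integral {μ : Measure EReal} (hμ : ∀ᵐ z ∂μ, z ≤ 0) {t : ℝ} (ht : 0 < t) :
    tCauchy μ t = ∫ z, cauchyKernel t z ∂μ := by
  have hmeas : MeasurableSet (Set.range ((↑) : ℝ → EReal)) :=
    EReal.measurableEmbedding_coe.measurableSet_range
  have h1 : cauchyTransform μ t =
      ((∫ z in Set.range ((↑) : ℝ → EReal), (t - z.toReal)⁻¹ ∂μ : ℝ) : ℂ) := by
    rw [cauchyTransform, ← integral_complex_ofReal]
    simp
  rw [tCauchy, h1, ← Complex.ofReal_mul, Complex.ofReal_re, ← integral_const_mul,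
    ← integral_indicator hmeas]
  refine integral_congr_ae ?_
  filter_upwards [hμ] with z hz
  obtain rfl | ⟨r, hr, rfl⟩ := EReal.eq_bot_or_coe_of_nonpos hz
  · rw [cauchyKernel_bot, Set.indicator_of_notMem]
    rintro ⟨r, hr⟩
    exact EReal.coe_ne_bot r hr
  · rw [cauchyKernel_coe ht hr, Set.indicator_of_mem (Set.mem_range_self r), EReal.toReal_coe, div_eq_mul_inv]

/-! ### The kernels determine a measure -/

/-- The function `z ↦ t / (t - z)` as a continuous function on `[-∞, 0]`, for `t > 0`. -/
noncomputable def cauchyKernelMap (t : Set.Ioi (0 : ℝ)) : C(Set.Iic (0 : EReal), ℝ) :=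
  ⟨fun z => cauchyKernel t z, (continuous_cauchyKernel t.2).comp continuous_subtype_val⟩

/-- The span of the constants and of the functions `z ↦ t / (t - z)`, `t > 0`. -/
noncomputable def cauchyKernelSpan : Submodule ℝ C(Set.Iic (0 : EReal), ℝ) :=
  Submodule.span ℝ (insert 1 (Set.range cauchyKernelMap))

instance : CompactSpace (Set.Iic (0 : EReal)) := isCompact_iff_compactSpace.1 isClosed_Iic.isCompact

theorem cauchyKernelMap_mul_mem_of_ne {s t : Set.Ioi (0 : ℝ)} (hst : s ≠ t) :
    cauchyKernelMap s * cauchyKernelMap t ∈ cauchyKernelSpan := by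
  have hst' : (s : ℝ) ≠ t := fun h => hst (Subtype.ext h)
  have : cauchyKernelMap s * cauchyKernelMap t =
      ((t : ℝ) / (t - s)) • cauchyKernelMap s - ((s : ℝ) / (t - s)) • cauchyKernelMap t := by
    ext z
    exact cauchyKernel_mul s.2 t.2 hst' z.2
  rw [this]
  exact Submodule.sub_mem _
    (Submodule.smul_mem _ _ (Submodule.subset_span (Or.inr ⟨s, rfl⟩)))
    (Submodule.smul_mem _ _ (Submodule.subset_span (Or.inr ⟨t, rfl⟩)))

theorem continuous_cauchyKernelMap : Continuous cauchyKernelMap := by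
  refine continuous_iff_continuousAt.2 fun t => ?_
  rw [ContinuousAt, tendsto_iff_norm_sub_tendsto_zero]
  have h0 : Tendsto (fun s : Set.Ioi (0 : ℝ) => |(s : ℝ) - t| / t) (𝓝 t) (𝓝 0) := by
    have : ContinuousAt (fun s : Set.Ioi (0 : ℝ) => |(s : ℝ) - t| / t) t := by fun_prop
    simpa [ContinuousAt] using this
  refine squeeze_zero (fun s => norm_nonneg _) (fun s => ?_) h0
  have htpos : (0 : ℝ) < t := t.2
  rw [ContinuousMap.norm_le _ (by positivity)]
  exact fun z => abs_cauchyKernel_sub_le s.2 t.2 z.2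

theorem cauchyKernelMap_mul_mem (s t : Set.Ioi (0 : ℝ)) :
    cauchyKernelMap s * cauchyKernelMap t ∈ cauchyKernelSpan.topologicalClosure := by
  rcases eq_or_ne s t with rfl | hst
  · have h1 : Tendsto (fun n : ℕ => (⟨(s : ℝ) + 1 / ((n : ℝ) + 1), by
        have : (0 : ℝ) < s := s.2
        exact Set.mem_Ioi.2 (by positivity)⟩ : Set.Ioi (0 : ℝ))) atTop (𝓝 s) := by
      rw [tendsto_subtype_rng]
      simpa using tendsto_one_div_add_atTop_nhds_zero_nat.const_add (s : ℝ)
    refine mem_closure_of_tendsto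
      (((continuous_cauchyKernelMap.tendsto s).comp h1).mul_const (cauchyKernelMap s))
      (Eventually.of_forall fun n => cauchyKernelMap_mul_mem_of_ne fun h => ?_)
    have h2 := congrArg Subtype.val h
    have h3 : (0 : ℝ) < 1 / ((n : ℝ) + 1) := by positivity
    simp only at h2
    linarith
  · exact Submodule.le_topologicalClosure _ (cauchyKernelMap_mul_mem_of_ne hst)

theorem mul_mem_cauchyKernelSpan {f g : C(Set.Iic (0 : EReal), ℝ)}
    (hf : f ∈ cauchyKernelSpan.topologicalClosure)
    (hg : g ∈ cauchyKernelSpan.topologicalClosure) :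
    f * g ∈ cauchyKernelSpan.topologicalClosure := by
  have h1 : ∀ f ∈ cauchyKernelSpan, ∀ g ∈ cauchyKernelSpan,
      f * g ∈ cauchyKernelSpan.topologicalClosure := by
    intro f hf g hg
    induction hf, hg using Submodule.span_induction₂ with
    | mem_mem x y hx hy =>
      rcases hx with rfl | ⟨s, rfl⟩
      · rw [one_mul]; exact Submodule.le_topologicalClosure _ (Submodule.subset_span hy)
      rcases hy with rfl | ⟨t, rfl⟩
      · rw [mul_one]
        exact Submodule.le_topologicalClosure _ (Submodule.subset_span (Or.inr ⟨s, rfl⟩))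
      · exact cauchyKernelMap_mul_mem s t
    | zero_left y _ => simp
    | zero_right x _ => simp
    | add_left x y z _ _ _ h1 h2 => rw [add_mul]; exact Submodule.add_mem _ h1 h2
    | add_right x y z _ _ _ h1 h2 => rw [mul_add]; exact Submodule.add_mem _ h1 h2
    | smul_left r x y _ _ h => rw [smul_mul_assoc]; exact Submodule.smul_mem _ _ h
    | smul_right r x y _ _ h => rw [mul_smul_comm]; exact Submodule.smul_mem _ _ h
  have h2 := map_mem_closure₂ (continuous_mul (M := C(Set.Iic (0 : EReal), ℝ))) hf hg h1
  exact cauchyKernelSpan.isClosed_topologicalClosure.closure_subset h2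

theorem topologicalClosure_cauchyKernelSpan : cauchyKernelSpan.topologicalClosure = ⊤ := by
  let A : Subalgebra ℝ C(Set.Iic (0 : EReal), ℝ) :=
    cauchyKernelSpan.topologicalClosure.toSubalgebra
      (Submodule.le_topologicalClosure _ (Submodule.subset_span (Or.inl rfl)))
      fun _ _ => mul_mem_cauchyKernelSpan
  have hA : A.SeparatesPoints := by
    intro x y hxy
    refine ⟨_, ⟨cauchyKernelMap ⟨1, Set.mem_Ioi.2 one_pos⟩,
      Submodule.le_topologicalClosure _ (Submodule.subset_span (Or.inr ⟨_, rfl⟩)), rfl⟩, ?_⟩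
    intro h
    have h' : cauchyKernel 1 x = cauchyKernel 1 y := h
    refine hxy (Subtype.ext ?_)
    obtain hx | ⟨r, hr, hx⟩ := EReal.eq_bot_or_coe_of_nonpos x.2 <;>
    obtain hy | ⟨q, hq, hy⟩ := EReal.eq_bot_or_coe_of_nonpos y.2
    · rw [hx, hy]
    · rw [hx, hy, cauchyKernel_bot, cauchyKernel_coe one_pos hq] at h'
      exact absurd h'.symm (div_ne_zero one_ne_zero (by linarith))
    · rw [hx, hy, cauchyKernel_bot, cauchyKernel_coe one_pos hr] at h'
      exact absurd h' (div_ne_zero one_ne_zero (by linarith))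
    · rw [hx, hy, cauchyKernel_coe one_pos hr, cauchyKernel_coe one_pos hq,
        div_eq_div_iff (by linarith) (by linarith)] at h'
      rw [hx, hy, EReal.coe_eq_coe_iff]
      linarith
  have h1 := ContinuousMap.subalgebra_topologicalClosure_eq_top_of_separatesPoints A hA
  refine eq_top_iff.2 fun f _ => ?_
  have h2 : f ∈ A.topologicalClosure := h1 ▸ Algebra.mem_top
  exact cauchyKernelSpan.isClosed_topologicalClosure.closure_subset h2

theorem ext_of_integral_cauchyKernel {μ ν : Measure EReal} [IsProbabilityMeasure μ]
    [IsProbabilityMeasure ν] (hμ : ∀ᵐ z ∂μ, z ≤ 0) (hν : ∀ᵐ z ∂ν, z ≤ 0)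
    (h : ∀ t, 0 < t → ∫ z, cauchyKernel t z ∂μ = ∫ z, cauchyKernel t z ∂ν) : μ = ν := by
  have hI : MeasurableSet (Set.Iic (0 : EReal)) := measurableSet_Iic
  have hint : ∀ (ρ : Measure EReal), (∀ᵐ z ∂ρ, z ≤ 0) → ∀ f : EReal → ℝ,
      ∫ z : Set.Iic (0 : EReal), f z ∂(ρ.comap Subtype.val) = ∫ z, f z ∂ρ := by
    intro ρ hρ f
    rw [integral_subtype_comap hI]
    exact setIntegral_eq_integral_of_ae_compl_eq_zero
      (by filter_upwards [hρ] with z hz hz'; exact absurd hz hz')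
  have hfin : ∀ (ρ : Measure EReal) [IsProbabilityMeasure ρ],
      IsFiniteMeasure (ρ.comap (Subtype.val : Set.Iic (0 : EReal) → EReal)) := by
    intro ρ _
    refine ⟨?_⟩
    rw [comap_subtype_coe_apply hI]
    exact measure_lt_top _ _
  have := hfin μ
  have := hfin ν
  set μ' := μ.comap (Subtype.val : Set.Iic (0 : EReal) → EReal)
  set ν' := ν.comap (Subtype.val : Set.Iic (0 : EReal) → EReal)
  have hi : ∀ (ρ : Measure (Set.Iic (0 : EReal))) [IsFiniteMeasure ρ]
      (f : C(Set.Iic (0 : EReal), ℝ)), Integrable f ρ := fun ρ _ f =>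
    (BoundedContinuousFunction.mkOfCompact f).integrable ρ
  have hcont : ∀ (ρ : Measure (Set.Iic (0 : EReal))) [IsFiniteMeasure ρ],
      Continuous fun f : C(Set.Iic (0 : EReal), ℝ) => ∫ z, f z ∂ρ := by
    intro ρ _
    refine (LipschitzWith.of_dist_le' (K := ρ.real Set.univ) fun f g => ?_).continuous
    rw [dist_eq_norm, dist_eq_norm, ← integral_sub (hi ρ f) (hi ρ g), mul_comm]
    exact norm_integral_le_of_norm_le_const
      (Eventually.of_forall fun z => (f - g).norm_coe_le_norm z)
  have key : ∀ f : C(Set.Iic (0 : EReal), ℝ), ∫ z, f z ∂μ' = ∫ z, f z ∂ν' := by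
    intro f
    have hf : f ∈ closure (cauchyKernelSpan : Set C(Set.Iic (0 : EReal), ℝ)) := by
      rw [← Submodule.topologicalClosure_coe, topologicalClosure_cauchyKernelSpan]; trivial
    refine closure_minimal (s := (cauchyKernelSpan : Set C(Set.Iic (0 : EReal), ℝ)))
      (t := {f | ∫ z, f z ∂μ' = ∫ z, f z ∂ν'}) (fun g hg => ?_)
      (isClosed_eq (hcont μ') (hcont ν')) hf
    simp only [Set.mem_ofPred_eq]
    induction hg using Submodule.span_induction with
    | mem x hx =>
      rcases hx with rfl | ⟨t, rfl⟩
      · have h1 := hint μ hμ fun _ => 1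
        have h2 := hint ν hν fun _ => 1
        simp only [integral_const, probReal_univ] at h1 h2
        simp only [ContinuousMap.one_apply, integral_const]
        exact h1.trans h2.symm
      · exact (hint μ hμ _).trans ((h t t.2).trans (hint ν hν _).symm)
    | zero => simp
    | add x y _ _ h1 h2 =>
      simp only [ContinuousMap.add_apply]
      rw [integral_add (hi _ _) (hi _ _), integral_add (hi _ _) (hi _ _), h1, h2]
    | smul r x _ h1 =>
      simp only [ContinuousMap.smul_apply, smul_eq_mul]
      rw [integral_const_mul, integral_const_mul, h1]
  refine ext_of_forall_integral_eq_of_IsFiniteMeasure fun f => ?_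
  rw [← hint μ hμ, ← hint ν hν]
  exact key ⟨fun z => f z, f.continuous.comp continuous_subtype_val⟩

/-! ### The function `t ↦ t G_μ(t)` -/

theorem bijOn_Ioo_of_strictMonoOn {f : ℝ → ℝ} {a b : ℝ} (hc : ContinuousOn f (Set.Ioi 0))
    (hm : StrictMonoOn f (Set.Ioi 0)) (ha : Tendsto f (𝓝[>] 0) (𝓝 a))
    (hb : Tendsto f atTop (𝓝 b)) : Set.BijOn f (Set.Ioi 0) (Set.Ioo a b) := by
  refine ⟨fun t ht => ?_, hm.injOn, fun y hy => ?_⟩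
  · have ht' : (0 : ℝ) < t := ht
    constructor
    · refine lt_of_le_of_lt (le_of_tendsto ha ?_)
        (hm (Set.mem_Ioi.2 (half_pos ht')) ht (half_lt_self ht'))
      filter_upwards [Ioo_mem_nhdsGT (half_pos ht')] with s hs
      exact (hm hs.1 (Set.mem_Ioi.2 (half_pos ht')) hs.2).le
    · refine lt_of_lt_of_le (hm ht (Set.mem_Ioi.2 (by linarith : 0 < t + 1)) (by linarith))
        (ge_of_tendsto hb ?_)
      filter_upwards [eventually_gt_atTop (t + 1)] with s hs
      exact (hm (Set.mem_Ioi.2 (by linarith : 0 < t + 1)) (Set.mem_Ioi.2 (by linarith)) hs).le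
  · obtain ⟨s, hs, hs0⟩ := ((ha.eventually_lt_const hy.1).and self_mem_nhdsWithin).exists
    obtain ⟨u, hu, hsu⟩ := ((hb.eventually_const_lt hy.2).and (eventually_gt_atTop s)).exists
    have hs0' : (0 : ℝ) < s := hs0
    have hsub : Set.Icc s u ⊆ Set.Ioi 0 := fun x hx => Set.mem_Ioi.2 (hs0'.trans_le hx.1)
    obtain ⟨x, hx, hxy⟩ := intermediate_value_Icc hsu.le (hc.mono hsub) ⟨hs.le, hu.le⟩
    exact ⟨x, hsub hx, hxy⟩

theorem norm_cauchyKernel_le_one {t : ℝ} (ht : 0 < t) {z : EReal} (hz : z ≤ 0) :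
    ‖cauchyKernel t z‖ ≤ 1 := by
  rw [Real.norm_eq_abs, abs_of_nonneg (cauchyKernel_nonneg ht z)]
  exact cauchyKernel_le_one ht hz

theorem tendsto_cauchyKernel_atTop {z : EReal} (hz : z ≤ 0) :
    Tendsto (fun t => cauchyKernel t z) atTop (𝓝 (({⊥}ᶜ : Set EReal).indicator 1 z)) := by
  obtain rfl | ⟨r, hr, rfl⟩ := EReal.eq_bot_or_coe_of_nonpos hz
  · simp [cauchyKernel_bot]
  · rw [Set.indicator_of_mem (by simp), Pi.one_apply]
    have h1 : Tendsto (fun t : ℝ => 1 + r * (t - r)⁻¹) atTop (𝓝 (1 + r * 0)) :=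
      ((tendsto_inv_atTop_zero.comp (tendsto_atTop_add_const_right _ (-r) tendsto_id)).const_mul
        r).const_add 1
    rw [mul_zero, add_zero] at h1
    refine h1.congr' ?_
    filter_upwards [eventually_gt_atTop 0] with t ht
    rw [cauchyKernel_coe ht hr]
    have : t - r ≠ 0 := by linarith
    field_simp
    ring

theorem tendsto_cauchyKernel_zero {z : EReal} (hz : z ≤ 0) :
    Tendsto (fun t => cauchyKernel t z) (𝓝[>] 0) (𝓝 (({0} : Set EReal).indicator 1 z)) := by
  obtain rfl | ⟨r, hr, rfl⟩ := EReal.eq_bot_or_coe_of_nonpos hz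
  · simp [cauchyKernel_bot]
  · rcases hr.eq_or_lt with rfl | hr'
    · rw [Set.indicator_of_mem (by simp), Pi.one_apply]
      refine tendsto_const_nhds.congr' ?_
      filter_upwards [self_mem_nhdsWithin] with t ht
      rw [cauchyKernel_coe ht le_rfl, sub_zero, div_self (ne_of_gt ht)]
    · rw [Set.indicator_of_notMem (by simpa using hr'.ne)]
      have h1 : ContinuousAt (fun t : ℝ => t / (t - r)) 0 :=
        continuousAt_id.div (continuousAt_id.sub continuousAt_const) (by simp [hr'.ne])
      have h2 : Tendsto (fun t : ℝ => t / (t - r)) (𝓝[>] 0) (𝓝 0) := by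
        simpa [ContinuousAt] using h1.tendsto.mono_left nhdsWithin_le_nhds
      refine h2.congr' ?_
      filter_upwards [self_mem_nhdsWithin] with t ht
      rw [cauchyKernel_coe ht hr]

theorem continuousAt_cauchyKernel {t : ℝ} (ht : 0 < t) {z : EReal} (hz : z ≤ 0) :
    ContinuousAt (fun t => cauchyKernel t z) t := by
  have h0 : ContinuousAt (fun s : ℝ => |s - t| / t) t := by fun_prop
  have h1 : Tendsto (fun s : ℝ => |s - t| / t) (𝓝 t) (𝓝 0) := by
    simpa [ContinuousAt] using h0
  rw [ContinuousAt, tendsto_iff_norm_sub_tendsto_zero]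
  refine squeeze_zero' (Eventually.of_forall fun s => norm_nonneg _) ?_ h1
  filter_upwards [eventually_gt_nhds ht] with s hs
  exact abs_cauchyKernel_sub_le hs ht hz

/-- For a probability measure on `[-∞, 0]` that is not concentrated on `{-∞, 0}`, the function
`t ↦ t G_μ(t)` is a bijection of `(0, ∞)` onto `(μ({0}), 1 - μ({-∞}))`. -/
theorem isTCauchyBij_massInterval {μ : Measure EReal} [IsProbabilityMeasure μ]
    (hμ : ∀ᵐ z ∂μ, z ≤ 0) (hI : (massInterval μ).Nonempty) :
    IsTCauchyBij μ (massInterval μ) := by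
  have heq : ∀ t, 0 < t → tCauchy μ t = ∫ z, cauchyKernel t z ∂μ :=
    fun t ht => tCauchy_eq_integral hμ ht
  have hbd : Integrable (fun _ : EReal => (1 : ℝ)) μ := integrable_const 1
  have hmeas : ∀ t, 0 < t → AEStronglyMeasurable (cauchyKernel t) μ :=
    fun t ht => (integrable_cauchyKernel ht μ).aestronglyMeasurable
  have hbound : ∀ t, 0 < t → ∀ᵐ z ∂μ, ‖cauchyKernel t z‖ ≤ 1 := fun t ht => by
    filter_upwards [hμ] with z hz using norm_cauchyKernel_le_one ht hz
  have hcont : ContinuousOn (tCauchy μ) (Set.Ioi 0) := by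
    intro t ht
    have h1 : ContinuousAt (fun t => ∫ z, cauchyKernel t z ∂μ) t := by
      refine continuousAt_of_dominated (bound := fun _ => 1) ?_ ?_ hbd ?_
      · filter_upwards [eventually_gt_nhds (Set.mem_Ioi.1 ht)] with s hs using hmeas s hs
      · filter_upwards [eventually_gt_nhds (Set.mem_Ioi.1 ht)] with s hs using hbound s hs
      · filter_upwards [hμ] with z hz using continuousAt_cauchyKernel ht hz
    exact h1.continuousWithinAt.congr heq (heq t ht)
  have hmono : StrictMonoOn (tCauchy μ) (Set.Ioi 0) := by
    intro s hs t ht hst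
    rw [heq s hs, heq t ht]
    have hle : ∀ᵐ z ∂μ, cauchyKernel s z ≤ cauchyKernel t z := by
      filter_upwards [hμ] with z hz using cauchyKernel_mono hs hst.le hz
    refine lt_of_le_of_ne (integral_mono_ae (integrable_cauchyKernel hs μ)
      (integrable_cauchyKernel ht μ) hle) fun h => ?_
    have h1 : (cauchyKernel s) =ᵐ[μ] (cauchyKernel t) :=
      (integral_eq_iff_of_ae_le (integrable_cauchyKernel hs μ)
        (integrable_cauchyKernel ht μ) hle).1 h
    have h2 : ∀ᵐ z ∂μ, z ∈ ({0} ∪ {⊥} : Set EReal) := by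
      filter_upwards [hμ, h1] with z hz hz'
      by_contra hc
      rw [Set.mem_union, not_or] at hc
      exact (cauchyKernel_lt hs hst (hz.lt_of_ne hc.1) hc.2).ne hz'
    have h3 : μ.real ({0} ∪ {⊥} : Set EReal) = 1 := by
      have h3' : μ ({0} ∪ {⊥} : Set EReal) = 1 :=
        (mem_ae_iff_prob_eq_one (by measurability)).1 h2
      rw [measureReal_def, h3', ENNReal.toReal_one]
    have h4 := measureReal_union_le (μ := μ) {(0 : EReal)} {⊥}
    obtain ⟨x, hx1, hx2⟩ := hI
    linarith
  refine ⟨hcont, hmono, bijOn_Ioo_of_strictMonoOn hcont hmono ?_ ?_⟩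
  · have h1 : Tendsto (fun t => ∫ z, cauchyKernel t z ∂μ) (𝓝[>] 0)
        (𝓝 (∫ z, ({0} : Set EReal).indicator 1 z ∂μ)) := by
      refine tendsto_integral_filter_of_dominated_convergence (fun _ => 1) ?_ ?_ hbd ?_
      · filter_upwards [self_mem_nhdsWithin] with s hs using hmeas s hs
      · filter_upwards [self_mem_nhdsWithin] with s hs using hbound s hs
      · filter_upwards [hμ] with z hz using tendsto_cauchyKernel_zero hz
    rw [integral_indicator_one (measurableSet_singleton _)] at h1
    refine h1.congr' ?_
    filter_upwards [self_mem_nhdsWithin] with s hs using (heq s hs).symm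
  · have h1 : Tendsto (fun t => ∫ z, cauchyKernel t z ∂μ) atTop
        (𝓝 (∫ z, ({⊥}ᶜ : Set EReal).indicator 1 z ∂μ)) := by
      refine tendsto_integral_filter_of_dominated_convergence (fun _ => 1) ?_ ?_ hbd ?_
      · filter_upwards [eventually_gt_atTop 0] with s hs using hmeas s hs
      · filter_upwards [eventually_gt_atTop 0] with s hs using hbound s hs
      · filter_upwards [hμ] with z hz using tendsto_cauchyKernel_atTop hz
    rw [integral_indicator_one (measurableSet_singleton _).compl,
      probReal_compl_eq_one_sub (measurableSet_singleton _)] at h1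
    refine h1.congr' ?_
    filter_upwards [eventually_gt_atTop 0] with s hs using (heq s hs).symm

/-! ### Empirical distributions of zeros -/

theorem integral_empiricalZeros (n : ℕ) (P : ℝ[X]) (f : EReal → ℝ) :
    ∫ z, f z ∂(empiricalZeros n P : Measure EReal) =
      (n : ℝ)⁻¹ * ((P.roots.map fun r : ℝ => f r).sum + ((n - P.natDegree : ℕ) : ℝ) * f ⊥) := by
  have hd : ∀ a : EReal, Integrable f ((diracProba a).toFiniteMeasure : Measure EReal) := fun a =>
    integrable_dirac enorm_lt_top
  have hid : ∀ a : EReal, ∫ z, f z ∂((diracProba a).toFiniteMeasure : Measure EReal) = f a := fun a =>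
    integral_dirac f a
  have key : ∀ m : Multiset ℝ,
      Integrable f ((m.map fun z : ℝ => (diracProba (z : EReal)).toFiniteMeasure).sum :
        FiniteMeasure EReal) ∧
      ∫ z, f z ∂(((m.map fun z : ℝ => (diracProba (z : EReal)).toFiniteMeasure).sum :
        FiniteMeasure EReal) : Measure EReal) = (m.map fun r : ℝ => f r).sum := by
    intro m
    induction m using Multiset.induction_on with
    | empty => simp
    | cons a m ih =>
      simp only [Multiset.map_cons, Multiset.sum_cons, FiniteMeasure.toMeasure_add]
      refine ⟨(hd a).add_measure ih.1, ?_⟩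
      rw [integral_add_measure (hd a) ih.1, ih.2, hid]
  have h2 : Integrable f (((n - P.natDegree) • (diracProba (⊥ : EReal)).toFiniteMeasure :
      FiniteMeasure EReal) : Measure EReal) := by
    rw [← Nat.cast_smul_eq_nsmul ℝ≥0, FiniteMeasure.toMeasure_smul]
    exact (hd ⊥).smul_measure_nnreal
  rw [empiricalZeros, FiniteMeasure.toMeasure_smul, integral_smul_nnreal_measure,
    FiniteMeasure.toMeasure_add, integral_add_measure (key P.roots).1 h2, (key P.roots).2,
    ← Nat.cast_smul_eq_nsmul ℝ≥0, FiniteMeasure.toMeasure_smul, integral_smul_nnreal_measure, hid]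
  rw [NNReal.smul_def, NNReal.smul_def, smul_eq_mul, smul_eq_mul, NNReal.coe_inv,
    NNReal.coe_natCast, NNReal.coe_natCast]

theorem real_univ_empiricalZeros {n : ℕ} (hn : 1 ≤ n) {P : ℝ[X]} (hP : HasNonposRoots P)
    (hdeg : P.natDegree ≤ n) : (empiricalZeros n P : Measure EReal).real Set.univ = 1 := by
  have h := integral_empiricalZeros n P fun _ => 1
  have hn' : (n : ℝ) ≠ 0 := Nat.cast_ne_zero.2 (by omega)
  rw [integral_const, smul_eq_mul, mul_one, Multiset.map_const', Multiset.sum_replicate,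
    ← hP.splits.natDegree_eq_card_roots, Nat.cast_sub hdeg, nsmul_eq_mul, mul_one, mul_one,
    add_sub_cancel, inv_mul_cancel₀ hn'] at h
  exact h

theorem ae_nonpos_empiricalZeros (n : ℕ) {P : ℝ[X]} (hP : HasNonposRoots P) :
    ∀ᵐ z ∂(empiricalZeros n P : Measure EReal), z ≤ 0 := by
  have hm : MeasurableSet (Set.Iic (0 : EReal))ᶜ := measurableSet_Iic.compl
  have h := integral_empiricalZeros n P ((Set.Iic (0 : EReal))ᶜ.indicator 1)
  have h1 : P.roots.map (fun r : ℝ => (Set.Iic (0 : EReal))ᶜ.indicator (1 : EReal → ℝ) r) =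
      P.roots.map fun _ => 0 := by
    refine Multiset.map_congr rfl fun r hr => Set.indicator_of_notMem ?_ _
    rw [Set.mem_compl_iff, not_not, Set.mem_Iic]
    exact_mod_cast hP.nonpos_of_mem_roots hr
  rw [h1, integral_indicator_one hm, Set.indicator_of_notMem (by simp)] at h
  simp only [Multiset.map_const', Multiset.sum_replicate, smul_zero, mul_zero, add_zero] at h
  rw [measureReal_def, ENNReal.toReal_eq_zero_iff] at h
  exact h.resolve_right (measure_ne_top _ _)

theorem integral_cauchyKernel_empiricalZeros (n : ℕ) {P : ℝ[X]} (hP : HasNonposRoots P) {t : ℝ}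
    (ht : 0 < t) :
    ∫ z, cauchyKernel t z ∂(empiricalZeros n P : Measure EReal) =
      (n : ℝ)⁻¹ * (t * P.derivative.eval t / P.eval t) := by
  rw [integral_empiricalZeros, cauchyKernel_bot, mul_zero, add_zero, mul_div_assoc,
    hP.splits.eval_derivative_div_eval_of_ne_zero (hP.eval_ne_zero ht),
    ← Multiset.sum_map_mul_left (a := t)]
  congr 2
  refine Multiset.map_congr rfl fun r hr => ?_
  rw [cauchyKernel_coe ht (hP.nonpos_of_mem_roots hr), mul_one_div]

/-! ### Increasing bijections of `(0, ∞)` onto an interval and their inverses -/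

/-- The function `f` is an increasing bijection of `(0, ∞)` onto `(a, b)` with inverse `τ`. -/
structure IsIncreasingInverse (f τ : ℝ → ℝ) (a b : ℝ) : Prop where
  mem : ∀ t, 0 < t → f t ∈ Set.Ioo a b
  pos : ∀ α ∈ Set.Ioo a b, 0 < τ α
  left_inv : ∀ t, 0 < t → τ (f t) = t
  right_inv : ∀ α ∈ Set.Ioo a b, f (τ α) = α
  strictMonoOn : StrictMonoOn τ (Set.Ioo a b)

namespace IsIncreasingInverse

variable {f τ g σ : ℝ → ℝ} {a b c d : ℝ}

theorem lt_iff (h : IsIncreasingInverse f τ a b) {s t : ℝ} (hs : 0 < s) (ht : 0 < t) :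
    f s < f t ↔ s < t := by
  rw [← h.strictMonoOn.lt_iff_lt (h.mem s hs) (h.mem t ht), h.left_inv s hs, h.left_inv t ht]

theorem apply_lt_iff (h : IsIncreasingInverse f τ a b) {t α : ℝ} (ht : 0 < t)
    (hα : α ∈ Set.Ioo a b) : f t < α ↔ t < τ α := by
  rw [← h.lt_iff ht (h.pos α hα), h.right_inv α hα]

theorem lt_apply_iff (h : IsIncreasingInverse f τ a b) {t α : ℝ} (ht : 0 < t)
    (hα : α ∈ Set.Ioo a b) : α < f t ↔ τ α < t := by
  rw [← h.lt_iff (h.pos α hα) ht, h.right_inv α hα]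

theorem image_eq (h : IsIncreasingInverse f τ a b) : τ '' Set.Ioo a b = Set.Ioi 0 :=
  Set.Subset.antisymm (Set.image_subset_iff.2 fun α hα => h.pos α hα)
    fun t ht => ⟨f t, h.mem t ht, h.left_inv t ht⟩

theorem continuousOn (h : IsIncreasingInverse f τ a b) : ContinuousOn τ (Set.Ioo a b) :=
  fun α hα => (h.strictMonoOn.continuousAt_of_image_mem_nhds (Ioo_mem_nhds hα.1 hα.2)
    (by rw [h.image_eq]; exact Ioi_mem_nhds (h.pos α hα))).continuousWithinAt

theorem exists_mul_lt (h : IsIncreasingInverse f τ a b) (h' : IsIncreasingInverse g σ c d)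
    {α ε : ℝ} (hα : α ∈ Set.Ioo a b) (hα' : α ∈ Set.Ioo c d) (hε : 0 < ε) (hca : c ≤ a) :
    ∃ β ∈ Set.Ioo a b ∩ Set.Ioo c d, τ β * σ β < ε := by
  have h1 := h.pos α hα
  have h2 := h'.pos α hα'
  have hm : 0 < min (τ α) (ε / σ α) := lt_min h1 (div_pos hε h2)
  set s := min (τ α) (ε / σ α) / 2 with hs
  have hs0 : 0 < s := half_pos hm
  have hs1 : s < τ α := (half_lt_self hm).trans_le (min_le_left _ _)
  have hs2 : s < ε / σ α := (half_lt_self hm).trans_le (min_le_right _ _)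
  have h3 := h.mem s hs0
  have h4 := (h.apply_lt_iff hs0 hα).2 hs1
  have h5 : f s ∈ Set.Ioo c d := ⟨hca.trans_lt h3.1, h4.trans hα'.2⟩
  refine ⟨f s, ⟨h3, h5⟩, ?_⟩
  rw [h.left_inv s hs0]
  exact (mul_lt_mul_of_pos_left (h'.strictMonoOn h5 hα' h4) hs0).trans ((lt_div_iff₀ h2).1 hs2)

theorem exists_lt_mul (h : IsIncreasingInverse f τ a b) (h' : IsIncreasingInverse g σ c d)
    {α ε : ℝ} (hα : α ∈ Set.Ioo a b) (hα' : α ∈ Set.Ioo c d) (hbd : b ≤ d) :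
    ∃ β ∈ Set.Ioo a b ∩ Set.Ioo c d, ε < τ β * σ β := by
  have h1 := h.pos α hα
  have h2 := h'.pos α hα'
  set s := max (τ α) (ε / σ α) + 1 with hs
  have hs1 : τ α < s := (le_max_left _ _).trans_lt (lt_add_one _)
  have hs2 : ε / σ α < s := (le_max_right _ _).trans_lt (lt_add_one _)
  have hs0 : 0 < s := h1.trans hs1
  have h3 := h.mem s hs0
  have h4 := (h.lt_apply_iff hs0 hα).2 hs1
  have h5 : f s ∈ Set.Ioo c d := ⟨hα'.1.trans h4, h3.2.trans_le hbd⟩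
  refine ⟨f s, ⟨h3, h5⟩, ?_⟩
  rw [h.left_inv s hs0]
  exact ((div_lt_iff₀ h2).1 hs2).trans (mul_lt_mul_of_pos_left (h'.strictMonoOn hα' h5 h4) hs0)

/-- The product of two increasing inverses is an increasing inverse on the intersection of their
domains. -/
theorem exists_mul (h : IsIncreasingInverse f τ a b) (h' : IsIncreasingInverse g σ c d)
    (hne : (Set.Ioo a b ∩ Set.Ioo c d).Nonempty) :
    ∃ l, IsIncreasingInverse l (fun α => τ α * σ α) (max a c) (min b d) := by
  obtain ⟨α, hα, hα'⟩ := hne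
  have hmono : StrictMonoOn (fun α => τ α * σ α) (Set.Ioo a b ∩ Set.Ioo c d) :=
    fun x hx y hy hxy => mul_lt_mul'' (h.strictMonoOn hx.1 hy.1 hxy)
      (h'.strictMonoOn hx.2 hy.2 hxy) (h.pos x hx.1).le (h'.pos x hx.2).le
  have hcont : ContinuousOn (fun α => τ α * σ α) (Set.Ioo a b ∩ Set.Ioo c d) :=
    (h.continuousOn.mono Set.inter_subset_left).mul (h'.continuousOn.mono Set.inter_subset_right)
  have hsurj : ∀ t, 0 < t → ∃ β ∈ Set.Ioo a b ∩ Set.Ioo c d, τ β * σ β = t := by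
    intro t ht
    have hlow : ∃ β ∈ Set.Ioo a b ∩ Set.Ioo c d, τ β * σ β < t := by
      rcases le_total c a with hca | hac
      · exact h.exists_mul_lt h' hα hα' ht hca
      · obtain ⟨β, hβ, hlt⟩ := h'.exists_mul_lt h hα' hα ht hac
        exact ⟨β, hβ.symm, by rwa [mul_comm]⟩
    have hhigh : ∃ β ∈ Set.Ioo a b ∩ Set.Ioo c d, t < τ β * σ β := by
      rcases le_total b d with hbd | hdb
      · exact h.exists_lt_mul h' hα hα' hbd
      · obtain ⟨β, hβ, hlt⟩ := h'.exists_lt_mul h hα' hα (ε := t) hdb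
        exact ⟨β, hβ.symm, by rwa [mul_comm]⟩
    obtain ⟨x, hx, hxt⟩ := hlow
    obtain ⟨y, hy, hyt⟩ := hhigh
    have hpre : IsPreconnected (Set.Ioo a b ∩ Set.Ioo c d) := by
      rw [Set.Ioo_inter_Ioo]; exact isPreconnected_Ioo
    exact hpre.intermediate_value hx hy hcont ⟨hxt.le, hyt.le⟩
  choose! l hl1 hl2 using hsurj
  rw [Set.Ioo_inter_Ioo] at hl1 hmono
  refine ⟨l, hl1, fun β hβ => ?_, hl2, fun β hβ => ?_, hmono⟩
  · rw [← Set.Ioo_inter_Ioo] at hβ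
    exact mul_pos (h.pos β hβ.1) (h'.pos β hβ.2)
  · have hpos : 0 < τ β * σ β := by
      rw [← Set.Ioo_inter_Ioo] at hβ
      exact mul_pos (h.pos β hβ.1) (h'.pos β hβ.2)
    exact hmono.injOn (hl1 _ hpos) hβ (hl2 _ hpos)

end IsIncreasingInverse

theorem IsTCauchyBij.isIncreasingInverse {μ : Measure EReal} {a b : ℝ}
    (h : IsTCauchyBij μ (Set.Ioo a b)) :
    IsIncreasingInverse (tCauchy μ) (tCauchyInv μ) a b := by
  obtain ⟨-, hm, hb⟩ := h
  have hpos : ∀ α ∈ Set.Ioo a b, 0 < tCauchyInv μ α := fun α hα =>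
    Function.invFunOn_mem (hb.surjOn hα)
  have hright : ∀ α ∈ Set.Ioo a b, tCauchy μ (tCauchyInv μ α) = α := fun α hα =>
    Function.invFunOn_eq (hb.surjOn hα)
  refine ⟨fun t ht => hb.mapsTo ht, hpos, fun t ht => ?_, hright, fun α hα β hβ hαβ => ?_⟩
  · exact hb.injOn (hpos _ (hb.mapsTo ht)) ht (hright _ (hb.mapsTo ht))
  · rw [← hm.lt_iff_lt (hpos α hα) (hpos β hβ), hright α hα, hright β hβ]
    exact hαβ

/-! ### Ratios of consecutive coefficients -/

theorem eventually_add_lt_mul {x : ℕ → ℝ} {l α : ℝ}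
    (hx : Tendsto (fun n : ℕ => (n : ℝ)⁻¹ * x n) atTop (𝓝 l)) (hl : l < α) (C : ℝ) :
    ∀ᶠ n : ℕ in atTop, x n + C < α * n := by
  have h1 := hx.add ((tendsto_inv_atTop_nhds_zero_nat (𝕜 := ℝ)).mul_const C)
  rw [zero_mul, add_zero] at h1
  filter_upwards [h1.eventually_lt_const hl, eventually_gt_atTop 0] with n hn hn0
  have hn0' : (0 : ℝ) < n := Nat.cast_pos.2 hn0
  rw [← mul_add, inv_mul_lt_iff₀ hn0'] at hn
  linarith

theorem eventually_mul_add_lt {x : ℕ → ℝ} {l α : ℝ}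
    (hx : Tendsto (fun n : ℕ => (n : ℝ)⁻¹ * x n) atTop (𝓝 l)) (hl : α < l) (C : ℝ) :
    ∀ᶠ n : ℕ in atTop, α * n + C < x n := by
  have h1 : Tendsto (fun n : ℕ => (n : ℝ)⁻¹ * (-x n)) atTop (𝓝 (-l)) := by
    simpa only [mul_neg] using hx.neg
  filter_upwards [eventually_add_lt_mul h1 (neg_lt_neg hl) C] with n hn
  linarith

theorem eventually_mul_add_lt_mul {α β : ℝ} (h : α < β) (C : ℝ) :
    ∀ᶠ n : ℕ in atTop, α * n + C < β * n := by
  refine eventually_add_lt_mul (tendsto_const_nhds.congr' ?_) h C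
  filter_upwards [eventually_gt_atTop 0] with n hn
  have hn0' : (n : ℝ) ≠ 0 := Nat.cast_ne_zero.2 hn.ne'
  field_simp

/-- Convergence of the logarithmic derivatives gives convergence of the ratios of consecutive
coefficients. -/
theorem tendsto_coeff_ratio {P : ℕ → ℝ[X]} (hP : ∀ᶠ n in atTop, HasNonposRoots (P n))
    {f τ : ℝ → ℝ} {a b : ℝ} (h : IsIncreasingInverse f τ a b) (ha : 0 ≤ a)
    (hlim : ∀ t, 0 < t → Tendsto (fun n : ℕ =>
      (n : ℝ)⁻¹ * (t * (P n).derivative.eval t / (P n).eval t)) atTop (𝓝 (f t)))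
    {α : ℝ} (hα : α ∈ Set.Ioo a b) :
    (∀ᶠ n : ℕ in atTop, (P n).coeff ⌊α * n⌋₊ ≠ 0 ∧ (P n).coeff (⌊α * n⌋₊ + 1) ≠ 0) ∧
      Tendsto (fun n : ℕ => (P n).coeff ⌊α * n⌋₊ / (P n).coeff (⌊α * n⌋₊ + 1)) atTop
        (𝓝 (τ α)) := by
  have hα0 : 0 ≤ α := ha.trans hα.1.le
  have hτ := h.pos α hα
  have hfl : ∀ n : ℕ, (⌊α * n⌋₊ : ℝ) ≤ α * n := fun n => Nat.floor_le (by positivity)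
  have hfl' : ∀ n : ℕ, α * n < ⌊α * n⌋₊ + 1 := fun n => Nat.lt_floor_add_one _
  have hne : ∀ᶠ n : ℕ in atTop,
      (P n).coeff ⌊α * n⌋₊ ≠ 0 ∧ (P n).coeff (⌊α * n⌋₊ + 1) ≠ 0 := by
    have hlt : 0 < τ α / 2 := half_pos hτ
    have hgt : 0 < τ α * 2 := by positivity
    filter_upwards [hP,
      eventually_add_lt_mul (hlim _ hlt) ((h.apply_lt_iff hlt hα).2 (by linarith)) 1,
      eventually_mul_add_lt (hlim _ hgt) ((h.lt_apply_iff hgt hα).2 (by linarith)) 1]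
      with n hPn h1 h2
    have h3 := hfl n
    have h4 := hfl' n
    obtain ⟨i, hi, hi0⟩ := hPn.exists_coeff_ne_zero_lt hlt (k := ⌊α * n⌋₊) (by linarith)
    obtain ⟨j, hj, hj0⟩ := hPn.exists_lt_coeff_ne_zero hgt (k := ⌊α * n⌋₊ + 1)
      (by push_cast; linarith)
    exact ⟨hPn.coeff_ne_zero hi0 hj0 (by omega) (by omega),
      hPn.coeff_ne_zero hi0 hj0 (by omega) (by omega)⟩
  refine ⟨hne, tendsto_order.2 ⟨fun s hs => ?_, fun s hs => ?_⟩⟩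
  · have hs' : max s 0 < τ α := max_lt hs hτ
    set t := (max s 0 + τ α) / 2 with ht
    have ht0 : 0 < t := by have := le_max_right s 0; linarith
    have hst : max s 0 < t := by linarith
    have hr : 0 ≤ max s 0 / t := div_nonneg (le_max_right _ _) ht0.le
    have hr1 : max s 0 / t < 1 := (div_lt_one ht0).2 hst
    filter_upwards [hP, hne, eventually_add_lt_mul (hlim t ht0)
      ((h.apply_lt_iff ht0 hα).2 (by linarith)) (max s 0 / t / (1 - max s 0 / t) + 1)]
      with n hPn hn h1
    by_contra hcon
    have h2 := hPn.le_mean ht0 hr hr1 hn.2 (by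
      rw [div_mul_cancel₀ _ ht0.ne']; exact (not_lt.1 hcon).trans (le_max_left _ _))
    have := hfl' n
    linarith
  · set t := (s + τ α) / 2 with ht
    have ht0 : 0 < t := by linarith
    have hs0 : 0 < s := hτ.trans hs
    have hr : 0 ≤ t / s := by positivity
    have hr1 : t / s < 1 := (div_lt_one hs0).2 (by linarith)
    filter_upwards [hP, hne, eventually_mul_add_lt (hlim t ht0)
      ((h.lt_apply_iff ht0 hα).2 (by linarith)) (t / s / (1 - t / s))] with n hPn hn h1
    by_contra hcon
    have h2 := hPn.mean_le ht0 hr hr1 hn.1 hn.2 (by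
      calc t = t / s * s := (div_mul_cancel₀ _ hs0.ne').symm
        _ ≤ _ := mul_le_mul_of_nonneg_left (not_lt.1 hcon) hr)
    have := hfl n
    linarith

/-- Convergence of the ratios of consecutive coefficients gives convergence of the logarithmic
derivatives. -/
theorem tendsto_mean_of_coeff_ratio {P : ℕ → ℝ[X]} (hP : ∀ᶠ n in atTop, HasNonposRoots (P n))
    {f τ : ℝ → ℝ} {a b : ℝ} (h : IsIncreasingInverse f τ a b) (ha : 0 ≤ a)
    (hne : ∀ α ∈ Set.Ioo a b, ∀ᶠ n : ℕ in atTop,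
      (P n).coeff ⌊α * n⌋₊ ≠ 0 ∧ (P n).coeff (⌊α * n⌋₊ + 1) ≠ 0)
    (hlim : ∀ α ∈ Set.Ioo a b, Tendsto (fun n : ℕ =>
      (P n).coeff ⌊α * n⌋₊ / (P n).coeff (⌊α * n⌋₊ + 1)) atTop (𝓝 (τ α)))
    {t : ℝ} (ht : 0 < t) :
    Tendsto (fun n : ℕ => (n : ℝ)⁻¹ * (t * (P n).derivative.eval t / (P n).eval t)) atTop
      (𝓝 (f t)) := by
  have hft := h.mem t ht
  refine tendsto_order.2 ⟨fun β hβ => ?_, fun β hβ => ?_⟩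
  · obtain ⟨α, hα1, hα2⟩ := exists_between (max_lt hβ hft.1)
    have hα : α ∈ Set.Ioo a b := ⟨(le_max_right _ _).trans_lt hα1, hα2.trans hft.2⟩
    have hτ := h.pos α hα
    have hτt := (h.lt_apply_iff ht hα).1 hα2
    set s := (τ α + t) / 2 with hs
    have hr : 0 ≤ s / t := div_nonneg (by linarith) ht.le
    have hr1 : s / t < 1 := (div_lt_one ht).2 (by linarith)
    filter_upwards [hP, hne α hα, (hlim α hα).eventually_lt_const (show τ α < s by linarith),
      eventually_mul_add_lt_mul ((le_max_left _ _).trans_lt hα1) (s / t / (1 - s / t)),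
      eventually_gt_atTop 0] with n hPn hn h1 h2 hn0
    have h3 := hPn.le_mean ht hr hr1 hn.2 (by rw [div_mul_cancel₀ _ ht.ne']; exact h1.le)
    have h4 : α * n < ⌊α * n⌋₊ + 1 := Nat.lt_floor_add_one _
    have hn0' : (0 : ℝ) < n := Nat.cast_pos.2 hn0
    rw [lt_inv_mul_iff₀ hn0']
    linarith
  · obtain ⟨α, hα1, hα2⟩ := exists_between (lt_min hβ hft.2)
    have hα : α ∈ Set.Ioo a b := ⟨hft.1.trans hα1, hα2.trans_le (min_le_right _ _)⟩
    have hτ := h.pos α hα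
    have hτt := (h.apply_lt_iff ht hα).1 hα1
    set s := (τ α + t) / 2 with hs
    have hs0 : 0 < s := by linarith
    have hr : 0 ≤ t / s := by positivity
    have hr1 : t / s < 1 := (div_lt_one hs0).2 (by linarith)
    filter_upwards [hP, hne α hα, (hlim α hα).eventually_const_lt (show s < τ α by linarith),
      eventually_mul_add_lt_mul (hα2.trans_le (min_le_left _ _)) (t / s / (1 - t / s)),
      eventually_gt_atTop 0] with n hPn hn h1 h2 hn0
    have h3 := hPn.mean_le ht hr hr1 hn.1 hn.2 (by
      calc t = t / s * s := (div_mul_cancel₀ _ hs0.ne').symm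
        _ ≤ _ := mul_le_mul_of_nonneg_left h1.le hr)
    have h4 : (⌊α * n⌋₊ : ℝ) ≤ α * n :=
      Nat.floor_le (mul_nonneg (ha.trans hα.1.le) (Nat.cast_nonneg n))
    have hn0' : (0 : ℝ) < n := Nat.cast_pos.2 hn0
    rw [inv_mul_lt_iff₀ hn0']
    linarith

/-! ### Convergence of measures from convergence of the transforms -/

theorem ae_nonpos_of_apply_Iic {μ : ProbabilityMeasure EReal} (h : μ (Set.Iic 0) = 1) :
    ∀ᵐ z ∂(μ : Measure EReal), z ≤ 0 := by
  refine (mem_ae_iff_prob_eq_one measurableSet_Iic).2 ?_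
  rw [← ProbabilityMeasure.ennreal_coeFn_eq_coeFn_toMeasure, h, ENNReal.coe_one]

theorem apply_Iic_of_ae_nonpos {μ : ProbabilityMeasure EReal}
    (h : ∀ᵐ z ∂(μ : Measure EReal), z ≤ 0) : μ (Set.Iic 0) = 1 := by
  have := (mem_ae_iff_prob_eq_one measurableSet_Iic).1 h
  rwa [← ProbabilityMeasure.ennreal_coeFn_eq_coeFn_toMeasure, ENNReal.coe_eq_one] at this

theorem ProbabilityMeasure.ext_of_integral_cauchyKernel {μ ν : ProbabilityMeasure EReal}
    (hμ : ∀ᵐ z ∂(μ : Measure EReal), z ≤ 0) (hν : ∀ᵐ z ∂(ν : Measure EReal), z ≤ 0)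
    (h : ∀ t, 0 < t → ∫ z, cauchyKernel t z ∂(μ : Measure EReal) =
      ∫ z, cauchyKernel t z ∂(ν : Measure EReal)) : μ = ν :=
  ProbabilityMeasure.toMeasure_injective (_root_.ext_of_integral_cauchyKernel hμ hν h)

theorem tendsto_integral_cauchyKernel {ι : Type*} {l : Filter ι} {ν : ι → FiniteMeasure EReal}
    {μ : FiniteMeasure EReal} (h : Tendsto ν l (𝓝 μ)) {t : ℝ} (ht : 0 < t) :
    Tendsto (fun i => ∫ z, cauchyKernel t z ∂(ν i : Measure EReal)) l
      (𝓝 (∫ z, cauchyKernel t z ∂(μ : Measure EReal))) :=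
  FiniteMeasure.tendsto_iff_forall_integral_tendsto.1 h
    (BoundedContinuousFunction.mkOfCompact ⟨_, continuous_cauchyKernel ht⟩)

theorem exists_tendsto_of_integral_cauchyKernel {ν : ℕ → ProbabilityMeasure EReal} {f : ℝ → ℝ}
    (hν : ∀ᶠ n in atTop, ∀ᵐ z ∂(ν n : Measure EReal), z ≤ 0)
    (hf : ∀ t, 0 < t →
      Tendsto (fun n => ∫ z, cauchyKernel t z ∂(ν n : Measure EReal)) atTop (𝓝 (f t))) :
    ∃ μ : ProbabilityMeasure EReal, (∀ᵐ z ∂(μ : Measure EReal), z ≤ 0) ∧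
      (∀ t, 0 < t → ∫ z, cauchyKernel t z ∂(μ : Measure EReal) = f t) ∧
      Tendsto ν atTop (𝓝 μ) := by
  have key : ∀ (g : Ultrafilter ℕ) (μ : ProbabilityMeasure EReal), ↑g ≤ (atTop : Filter ℕ) →
      Tendsto ν g (𝓝 μ) → (∀ᵐ z ∂(μ : Measure EReal), z ≤ 0) ∧
        ∀ t, 0 < t → ∫ z, cauchyKernel t z ∂(μ : Measure EReal) = f t := by
    intro g μ hg hlim
    constructor
    · refine (mem_ae_iff_prob_eq_one measurableSet_Iic).2 (le_antisymm prob_le_one ?_)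
      refine le_trans (le_of_eq ?_)
        (ProbabilityMeasure.limsup_measure_closed_le_of_tendsto hlim (isClosed_Iic (a := 0)))
      have : (fun n => (ν n : Measure EReal) (Set.Iic 0)) =ᶠ[g] fun _ => 1 := by
        filter_upwards [hg hν] with n hn
        exact (mem_ae_iff_prob_eq_one measurableSet_Iic).1 hn
      rw [limsup_congr this, limsup_const]
    · intro t ht
      exact tendsto_nhds_unique (tendsto_integral_cauchyKernel
        ((ProbabilityMeasure.toFiniteMeasure_continuous.tendsto μ).comp hlim) ht)
        ((hf t ht).mono_left hg)
  have hex : ∀ g : Ultrafilter ℕ, ∃ μ, Tendsto ν g (𝓝 μ) := fun g => by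
    obtain ⟨μ, -, hμ⟩ := isCompact_univ.ultrafilter_le_nhds (g.map ν) (by simp)
    exact ⟨μ, hμ⟩
  obtain ⟨μ, hμ⟩ := hex (hyperfilter ℕ)
  obtain ⟨h1, h2⟩ := key _ μ Nat.hyperfilter_le_atTop hμ
  refine ⟨μ, h1, h2, (tendsto_iff_ultrafilter _ _ _).2 fun g hg => ?_⟩
  obtain ⟨μ', hμ'⟩ := hex g
  obtain ⟨h1', h2'⟩ := key g μ' hg hμ'
  have : μ' = μ := ProbabilityMeasure.ext_of_integral_cauchyKernel h1' h1 fun t ht =>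
    (h2' t ht).trans (h2 t ht).symm
  rwa [← this]

theorem tendsto_mean_of_tendsto_empiricalZeros {P : ℕ → ℝ[X]}
    (hroots : ∀ n, 1 ≤ n → HasNonposRoots (P n)) {μ : ProbabilityMeasure EReal}
    (hμ : ∀ᵐ z ∂(μ : Measure EReal), z ≤ 0)
    (hlim : Tendsto (fun n => empiricalZeros n (P n)) atTop (𝓝 μ.toFiniteMeasure)) {t : ℝ}
    (ht : 0 < t) :
    Tendsto (fun n : ℕ => (n : ℝ)⁻¹ * (t * (P n).derivative.eval t / (P n).eval t)) atTop
      (𝓝 (tCauchy μ t)) := by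
  rw [tCauchy_eq_integral hμ ht]
  refine (tendsto_integral_cauchyKernel hlim ht).congr' ?_
  filter_upwards [eventually_ge_atTop 1] with n hn
  exact integral_cauchyKernel_empiricalZeros n (hroots n hn) ht

theorem exists_tendsto_empiricalZeros {P : ℕ → ℝ[X]}
    (hroots : ∀ᶠ n in atTop, HasNonposRoots (P n)) (hdeg : ∀ n, (P n).natDegree ≤ n) {f : ℝ → ℝ}
    (hf : ∀ t, 0 < t → Tendsto (fun n : ℕ =>
      (n : ℝ)⁻¹ * (t * (P n).derivative.eval t / (P n).eval t)) atTop (𝓝 (f t))) :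
    ∃ μ : ProbabilityMeasure EReal, (∀ᵐ z ∂(μ : Measure EReal), z ≤ 0) ∧
      (∀ t, 0 < t → tCauchy μ t = f t) ∧
      Tendsto (fun n => empiricalZeros n (P n)) atTop (𝓝 μ.toFiniteMeasure) := by
  classical
  let ν : ℕ → ProbabilityMeasure EReal := fun n =>
    if h : IsProbabilityMeasure (empiricalZeros n (P n) : Measure EReal) then ⟨_, h⟩
    else diracProba 0
  have hν : ∀ᶠ n in atTop, (ν n).toFiniteMeasure = empiricalZeros n (P n) := by
    filter_upwards [hroots, eventually_ge_atTop 1] with n hn hn1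
    have h : IsProbabilityMeasure (empiricalZeros n (P n) : Measure EReal) :=
      ⟨(ENNReal.toReal_eq_one_iff _).1 (real_univ_empiricalZeros hn1 hn (hdeg n))⟩
    have hνn : ν n = ⟨_, h⟩ := dif_pos h
    rw [hνn]
    rfl
  have hν' : ∀ᶠ n in atTop, (ν n : Measure EReal) = empiricalZeros n (P n) := by
    filter_upwards [hν] with n hn
    rw [← hn]; rfl
  obtain ⟨μ, h1, h2, h3⟩ := exists_tendsto_of_integral_cauchyKernel (ν := ν) (f := f)
    (by
      filter_upwards [hν', hroots] with n hn hP
      rw [hn]; exact ae_nonpos_empiricalZeros n hP)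
    (fun t ht => (hf t ht).congr' (by
      filter_upwards [hν', hroots] with n hn hP
      rw [hn, integral_cauchyKernel_empiricalZeros n hP ht]))
  refine ⟨μ, h1, fun t ht => (tCauchy_eq_integral h1 ht).trans (h2 t ht), ?_⟩
  exact ((ProbabilityMeasure.toFiniteMeasure_continuous.tendsto μ).comp h3).congr' hν

/-! ### The zeros of Hadamard products -/

theorem IsIncreasingInverse.hasProductInverse {μ₁ μ₂ μ : Measure EReal} {l : ℝ → ℝ} {a b : ℝ}
    (h : IsIncreasingInverse l (fun α => tCauchyInv μ₁ α * tCauchyInv μ₂ α) a b)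
    (hI : massInterval μ₁ ∩ massInterval μ₂ = Set.Ioo a b)
    (hl : ∀ t, 0 < t → tCauchy μ t = l t) : HasProductInverse μ₁ μ₂ μ := by
  have hmono : StrictMonoOn (tCauchy μ) (Set.Ioi 0) := fun s hs t ht hst => by
    rw [hl s hs, hl t ht]; exact (h.lt_iff hs ht).2 hst
  have hbij : Set.BijOn (tCauchy μ) (Set.Ioi 0) (Set.Ioo a b) := by
    refine ⟨fun t ht => by rw [hl t ht]; exact h.mem t ht, hmono.injOn, fun α hα => ?_⟩
    exact ⟨_, h.pos α hα, by rw [hl _ (h.pos α hα)]; exact h.right_inv α hα⟩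
  unfold HasProductInverse
  rw [hI]
  refine ⟨⟨fun t ht => ?_, hmono, hbij⟩, fun α hα => ?_⟩
  · refine (hmono.continuousAt_of_image_mem_nhds (Ioi_mem_nhds ht) ?_).continuousWithinAt
    rw [hbij.image_eq]
    exact Ioo_mem_nhds (hbij.mapsTo ht).1 (hbij.mapsTo ht).2
  · have h1 : tCauchyInv μ α ∈ Set.Ioi 0 := Function.invFunOn_mem (hbij.surjOn hα)
    have h2 : tCauchy μ (tCauchyInv μ α) = α := Function.invFunOn_eq (hbij.surjOn hα)
    exact hbij.injOn h1 (h.pos α hα) (by rw [h2, hl _ (h.pos α hα)]; exact (h.right_inv α hα).symm)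

theorem IsIncreasingInverse.eq_of_hasProductInverse {μ₁ μ₂ ν : Measure EReal} {l : ℝ → ℝ}
    {a b : ℝ} (h : IsIncreasingInverse l (fun α => tCauchyInv μ₁ α * tCauchyInv μ₂ α) a b)
    (hI : massInterval μ₁ ∩ massInterval μ₂ = Set.Ioo a b) (hν : HasProductInverse μ₁ μ₂ ν) {t : ℝ}
    (ht : 0 < t) : tCauchy ν t = l t := by
  unfold HasProductInverse at hν
  rw [hI] at hν
  have h1 := hν.2 (l t) (h.mem t ht)
  have h2 : tCauchyInv ν (l t) = t := h1.trans (h.left_inv t ht)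
  have h3 := hν.1.isIncreasingInverse.right_inv _ (h.mem t ht)
  rwa [h2] at h3

theorem mainTheorem10
    (P₁ P₂ : ℕ → ℝ[X])
    (hdeg₁ : ∀ n, 1 ≤ n → (P₁ n).natDegree ≤ n)
    (hdeg₂ : ∀ n, 1 ≤ n → (P₂ n).natDegree ≤ n)
    (hroots₁ : ∀ n, 1 ≤ n → HasNonposRoots (P₁ n))
    (hroots₂ : ∀ n, 1 ≤ n → HasNonposRoots (P₂ n))
    (μ₁ μ₂ : ProbabilityMeasure EReal)
    (hμ₁ : μ₁ (Set.Iic 0) = 1)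
    (hμ₂ : μ₂ (Set.Iic 0) = 1)
    (hlim₁ : Tendsto (fun n => empiricalZeros n (P₁ n)) atTop (𝓝 μ₁.toFiniteMeasure))
    (hlim₂ : Tendsto (fun n => empiricalZeros n (P₂ n)) atTop (𝓝 μ₂.toFiniteMeasure))
    (hI : (massInterval μ₁ ∩ massInterval μ₂).Nonempty) :
    -- the zero distribution of the Hadamard product is defined for all large `n`
    (∀ᶠ n in atTop, HasNonposRoots (hadamardProduct n (P₁ n) (P₂ n))) ∧
    -- the inverses of `t ↦ t G_{μᵢ}(t)` are defined on the respective intervals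
    IsTCauchyBij μ₁ (massInterval μ₁) ∧
    IsTCauchyBij μ₂ (massInterval μ₂) ∧
    -- the limit exists, satisfies the rule and is determined by it
    ∃ μ : ProbabilityMeasure EReal,
      μ (Set.Iic 0) = 1 ∧
      Tendsto (fun n => empiricalZeros n (hadamardProduct n (P₁ n) (P₂ n))) atTop
        (𝓝 μ.toFiniteMeasure) ∧
      HasProductInverse μ₁ μ₂ μ ∧
      ∀ ν : ProbabilityMeasure EReal,
        ν (Set.Iic 0) = 1 → HasProductInverse μ₁ μ₂ ν → ν = μ := by
  have hae₁ := ae_nonpos_of_apply_Iic hμ₁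
  have hae₂ := ae_nonpos_of_apply_Iic hμ₂
  have hbij₁ := isTCauchyBij_massInterval hae₁ (hI.mono Set.inter_subset_left)
  have hbij₂ := isTCauchyBij_massInterval hae₂ (hI.mono Set.inter_subset_right)
  have hinv₁ := IsTCauchyBij.isIncreasingInverse hbij₁
  have hinv₂ := IsTCauchyBij.isIncreasingInverse hbij₂
  obtain ⟨l, hl⟩ := hinv₁.exists_mul hinv₂ hI
  have hinter : massInterval μ₁ ∩ massInterval μ₂ = _ := Set.Ioo_inter_Ioo
  have hJ₁ : ∀ α ∈ massInterval μ₁ ∩ massInterval μ₂, _ := fun α hα =>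
    tendsto_coeff_ratio (eventually_atTop.2 ⟨1, hroots₁⟩) hinv₁ measureReal_nonneg
      (fun t ht => tendsto_mean_of_tendsto_empiricalZeros hroots₁ hae₁ hlim₁ ht) hα.1
  have hJ₂ : ∀ α ∈ massInterval μ₁ ∩ massInterval μ₂, _ := fun α hα =>
    tendsto_coeff_ratio (eventually_atTop.2 ⟨1, hroots₂⟩) hinv₂ measureReal_nonneg
      (fun t ht => tendsto_mean_of_tendsto_empiricalZeros hroots₂ hae₂ hlim₂ ht) hα.2
  have hcoeff : ∀ᶠ n in atTop, ∀ k, (hadamardProduct n (P₁ n) (P₂ n)).coeff k =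
      (P₁ n).coeff k * (P₂ n).coeff k := by
    filter_upwards [eventually_ge_atTop 1] with n hn k
    exact coeff_hadamardProduct_of_natDegree_le (hdeg₁ n hn) _ k
  have hne : ∀ α ∈ massInterval μ₁ ∩ massInterval μ₂, ∀ᶠ n : ℕ in atTop,
      (hadamardProduct n (P₁ n) (P₂ n)).coeff ⌊α * n⌋₊ ≠ 0 ∧
        (hadamardProduct n (P₁ n) (P₂ n)).coeff (⌊α * n⌋₊ + 1) ≠ 0 := fun α hα => by
    filter_upwards [hcoeff, (hJ₁ α hα).1, (hJ₂ α hα).1] with n hn h1 h2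
    rw [hn, hn]
    exact ⟨mul_ne_zero h1.1 h2.1, mul_ne_zero h1.2 h2.2⟩
  have hratio : ∀ α ∈ massInterval μ₁ ∩ massInterval μ₂, Tendsto (fun n : ℕ =>
      (hadamardProduct n (P₁ n) (P₂ n)).coeff ⌊α * n⌋₊ /
        (hadamardProduct n (P₁ n) (P₂ n)).coeff (⌊α * n⌋₊ + 1)) atTop
      (𝓝 (tCauchyInv μ₁ α * tCauchyInv μ₂ α)) := fun α hα => by
    refine ((hJ₁ α hα).2.mul (hJ₂ α hα).2).congr' ?_
    filter_upwards [hcoeff] with n hn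
    rw [hn, hn, div_mul_div_comm]
  have hroots : ∀ᶠ n in atTop, HasNonposRoots (hadamardProduct n (P₁ n) (P₂ n)) := by
    obtain ⟨α, hα⟩ := hI
    filter_upwards [hne α hα, eventually_ge_atTop 1] with n h1 hn
    refine (hroots₁ n hn).hadamardProduct (hroots₂ n hn) (hdeg₁ n hn) (hdeg₂ n hn) fun h0 => ?_
    rw [h0, coeff_zero] at h1
    exact h1.1 rfl
  rw [hinter] at hne hratio
  obtain ⟨μ, hμ, hμl, hlim⟩ := exists_tendsto_empiricalZeros hroots
    (fun n => natDegree_hadamardProduct_le n _ _)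
    (fun t ht => tendsto_mean_of_coeff_ratio hroots hl (le_max_of_le_left measureReal_nonneg)
      hne hratio ht)
  refine ⟨hroots, hbij₁, hbij₂, μ, apply_Iic_of_ae_nonpos hμ, hlim,
    hl.hasProductInverse hinter hμl, fun ν hν hprod => ?_⟩
  have hνae := ae_nonpos_of_apply_Iic hν
  refine ProbabilityMeasure.ext_of_integral_cauchyKernel hνae hμ fun t ht => ?_
  rw [← tCauchy_eq_integral hνae ht, ← tCauchy_eq_integral hμ ht, hμl t ht]
  exact hl.eq_of_hasProductInverse hinter hprod ht
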